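/- Let $(M^7,g,\times)$ be a $G_2$-manifold: a Riemannian $7$-manifold with a smooth vector cross product $\times$ on its tangent spaces such that the $3$-form $\Omega(u,v,w)=g(u\times v,w)$ is parallel for the Levi-Civita connection $\nabla$. Let $C_t=\varphi(t,C)$, $0\le t\le\varepsilon$, be a smooth one-parameter family of coassociative submanifolds of $M$ ($\dim C_t=4$, $\Omega|_{C_t}=0$) whose initial velocity $n=\partial_t\varphi|_{t=0}$ is a nowhere vanishing smooth section of the normal bundle of $C=C_0$, and let $J_n u=|n|^{-1}\,n\times u$. Let $\Sigma\subset C$ be a $J_n$-holomorphic curve, that is, a surface whose tangent spaces are preserved by $J_n$. Let $N_{\Sigma/C}$ be the orthogonal complement of $T\Sigma$ in $TC|_\Sigma$, and let $N_{\mathcal C/M}|_\Sigma$ be the orthogonal complement of $T\mathcal C|_\Sigma=TC|_\Sigma\oplus\mathbb R n$ in $TM|_\Sigma$, where $\mathcal C=\bigcup_t C_t$; regard $T\Sigma$, $N_{\Sigma/C}$ and $N_{\mathcal C/M}|_\Sigma$ as complex line bundles with complex structure $J_n$. A subbundle $L$ of $TM|_\Sigma$ carries the induced connection $\nabla^L=\pi^L\circ\nabla$,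 where $\pi^L$ is the orthogonal projection onto $L$; the direct sum $N_{\Sigma/C}\oplus N_{\mathcal C/M}|_\Sigma$ carries the direct sum of the induced connections of its two summands. Put $\Lambda^{0,1}(N_{\Sigma/C})=N_{\Sigma/C}\otimes_{\mathbb C}\Lambda^{0,1}T^*\Sigma$, with the tensor product of the induced connections. (1) There is an isomorphism of smooth real vector bundles $f:\Lambda^{0,1}(N_{\Sigma/C})\to N_{\mathcal C/M}|_\Sigma$, conjugate linear on fibres, such that for every unit tangent vector $e_2$ of $\Sigma$, with $e_3=J_ne_2$, $Z=\tfrac1{\sqrt2}(e_2-ie_3)$, $\overline Z^*=\tfrac1{\sqrt2}(e_2^*-ie_3^*)$, and every $s\in N_{\Sigma/C}$ at the same point, $f(s\otimes\overline Z^*)=-\tfrac1{\sqrt2}\,s\times Z$, where $s\times(ie_3)$ means $(J_ns)\times e_3$. (2) Let $\bar{\partial}=\sum_i c(e_i)\nabla_{e_i}$ ($e_i$ an orthonormal basis of $T\Sigma$) be the Dolbeault Dirac operator on $N_{\Sigma/C}\oplus\Lambda^{0,1}(N_{\Sigma/C})$, with Clifford multiplication $c(v)u=\sqrt2\,(v^\flat)^{0,1}\otimes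 u$ on $N_{\Sigma/C}$ and $c(v)\beta=-\sqrt2\,\beta(v)$ on $\Lambda^{0,1}(N_{\Sigma/C})$, and let $D=\sum_i e_i\times\nabla_{e_i}$ be the Dirac operator on $N_{\Sigma/C}\oplus N_{\mathcal C/M}|_\Sigma$ with $G_2$ multiplication as Clifford multiplication. With $\Phi=\mathrm{id}\oplus f$, one has $\Phi(\bar\partial U)=D(\Phi U)$ for every smooth section $U$ of $N_{\Sigma/C}\oplus\Lambda^{0,1}(N_{\Sigma/C})$. -/

import Mathlib

open Bundle Manifold
open scoped ContDiff

noncomputable section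

namespace G2Dirac

/-- The model spaces of the 7-manifold, the 4-manifolds and the curve. -/
abbrev E7 := EuclideanSpace ℝ (Fin 7)
abbrev E4 := EuclideanSpace ℝ (Fin 4)
abbrev E2 := EuclideanSpace ℝ (Fin 2)

/-! ### `G₂`-geometry of a Riemannian 7-manifold -/

section Ambient

variable {M : Type*} [TopologicalSpace M] [ChartedSpace E7 M] [IsManifold (𝓡 7) ∞ M]
  [RiemannianBundle (fun p : M => TangentSpace (𝓡 7) p)]

/-- A smooth (2-fold) vector cross product on the tangent bundle of a Riemannian 7-manifold:
a skew bilinear product on each tangent space, with `u × v` perpendicular to `u` and `v`, and with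
`|u × v|` the area of the parallelogram spanned by `u` and `v`. -/
structure VectorCrossProduct (M : Type*) [TopologicalSpace M] [ChartedSpace E7 M]
    [IsManifold (𝓡 7) ∞ M] [RiemannianBundle (fun p : M => TangentSpace (𝓡 7) p)] where
  /-- the product on the tangent space at `p` -/
  cross : ∀ p : M, TangentSpace (𝓡 7) p →L[ℝ] TangentSpace (𝓡 7) p →L[ℝ] TangentSpace (𝓡 7) p
  skew : ∀ (p : M) (u v : TangentSpace (𝓡 7) p), cross p u v = - cross p v u
  perp_left : ∀ (p : M) (u v : TangentSpace (𝓡 7) p), inner ℝ (cross p u v) u = 0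
  perp_right : ∀ (p : M) (u v : TangentSpace (𝓡 7) p), inner ℝ (cross p u v) v = 0
  norm_sq : ∀ (p : M) (u v : TangentSpace (𝓡 7) p),
    ‖cross p u v‖ ^ 2 = ‖u‖ ^ 2 * ‖v‖ ^ 2 - (inner ℝ u v) ^ 2
  smooth : ContMDiff (𝓡 7) ((𝓡 7).prod 𝓘(ℝ, E7 →L[ℝ] E7 →L[ℝ] E7)) ∞
    (fun p : M => TotalSpace.mk' (E7 →L[ℝ] E7 →L[ℝ] E7)
      (E := fun p : M => TangentSpace (𝓡 7) p →L[ℝ] TangentSpace (𝓡 7) p →L[ℝ]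
        TangentSpace (𝓡 7) p) p (cross p))

/-- The 3-form `Ω(u, v, w) = g(u × v, w)`. -/
def VectorCrossProduct.Omega (X : VectorCrossProduct M) (p : M)
    (u v w : TangentSpace (𝓡 7) p) : ℝ :=
  inner ℝ (X.cross p u v) w

/-- `∇` is the Levi-Civita connection: it is metric and torsion-free. -/
def IsLeviCivita [IsContMDiffRiemannianBundle (𝓡 7) ∞ E7 (fun p : M => TangentSpace (𝓡 7) p)]
    (nabla : CovariantDerivative (𝓡 7) E7 (TangentSpace (𝓡 7) : M → Type _)) : Prop :=
  haveI : IsContMDiffRiemannianBundle (𝓡 7) 1 E7 (fun p : M => TangentSpace (𝓡 7) p) :=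
    IsContMDiffRiemannianBundle.of_le (n := ∞) (by norm_cast)
  nabla.IsMetricCompatible ∧ nabla.torsion = 0

/-- `∇Ω = 0`, i.e. `(M, g, ×)` is a `G₂`-manifold when `∇` is the Levi-Civita connection:
`d(Ω(Y, Z, W))(v) = Ω(∇_v Y, Z, W) + Ω(Y, ∇_v Z, W) + Ω(Y, Z, ∇_v W)` for all vector fields. -/
def VectorCrossProduct.IsParallel (X : VectorCrossProduct M)
    (nabla : CovariantDerivative (𝓡 7) E7 (TangentSpace (𝓡 7) : M → Type _)) : Prop :=
  ∀ (Y Z W : ∀ p : M, TangentSpace (𝓡 7) p) (p : M),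
    MDifferentiableAt (𝓡 7) ((𝓡 7).prod 𝓘(ℝ, E7)) (fun q => TotalSpace.mk' E7 q (Y q)) p →
    MDifferentiableAt (𝓡 7) ((𝓡 7).prod 𝓘(ℝ, E7)) (fun q => TotalSpace.mk' E7 q (Z q)) p →
    MDifferentiableAt (𝓡 7) ((𝓡 7).prod 𝓘(ℝ, E7)) (fun q => TotalSpace.mk' E7 q (W q)) p →
    ∀ v : TangentSpace (𝓡 7) p,
      mvfderiv (𝓡 7) (fun q => X.Omega q (Y q) (Z q) (W q)) p v =
        X.Omega p (nabla Y p v) (Z p) (W p) + X.Omega p (Y p) (nabla Z p v) (W p)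
          + X.Omega p (Y p) (Z p) (nabla W p v)

end Ambient

/-! ### Submanifolds -/

/-- `f` embeds `N` as a smooth submanifold: it is smooth, has injective differentials, and is a
homeomorphism onto its image. -/
structure EmbedsSubmanifold {E H E' H' : Type*} [NormedAddCommGroup E] [NormedSpace ℝ E]
    [TopologicalSpace H] (I : ModelWithCorners ℝ E H) [NormedAddCommGroup E'] [NormedSpace ℝ E']
    [TopologicalSpace H'] (I' : ModelWithCorners ℝ E' H')
    {N N' : Type*} [TopologicalSpace N] [ChartedSpace H N] [TopologicalSpace N']
    [ChartedSpace H' N'] (f : N → N') : Prop where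
  smooth : ContMDiff I I' ∞ f
  injective : ∀ x, Function.Injective (mfderiv I I' f x)
  embedding : Topology.IsEmbedding f

section Along

variable {M : Type*} [TopologicalSpace M] [ChartedSpace E7 M]

/-- `V` is a smooth section of `f^* TM` (a smooth vector field along `f`). -/
def SmoothAlong {E H : Type*} [NormedAddCommGroup E] [NormedSpace ℝ E] [TopologicalSpace H]
    (I : ModelWithCorners ℝ E H) {N : Type*} [TopologicalSpace N] [ChartedSpace H N]
    [IsManifold (𝓡 7) ∞ M] (f : N → M) (V : ∀ y, TangentSpace (𝓡 7) (f y)) : Prop :=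
  ContMDiff I ((𝓡 7).prod 𝓘(ℝ, E7)) ∞
    (fun y => (TotalSpace.mk' E7 (f y) (V y) : TangentBundle (𝓡 7) M))

/-- The tangent space of the submanifold `f` at `y`, as a subspace of `T_{f y} M`. -/
def tangentOf {E H : Type*} [NormedAddCommGroup E] [NormedSpace ℝ E] [TopologicalSpace H]
    (I : ModelWithCorners ℝ E H) {N : Type*} [TopologicalSpace N] [ChartedSpace H N]
    (f : N → M) (y : N) : Submodule ℝ (TangentSpace (𝓡 7) (f y)) :=
  (mfderiv I (𝓡 7) f y).range

instance finiteDimensional_tangent (p : M) : FiniteDimensional ℝ (TangentSpace (𝓡 7) p) :=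
  inferInstanceAs (FiniteDimensional ℝ E7)

end Along

/-! ### Coassociative families and holomorphic curves -/

section Family

variable {M : Type*} [TopologicalSpace M] [ChartedSpace E7 M] [IsManifold (𝓡 7) ∞ M]
  [RiemannianBundle (fun p : M => TangentSpace (𝓡 7) p)]
  {C : Type*} [TopologicalSpace C] [ChartedSpace E4 C]
  {S : Type*} [TopologicalSpace S] [ChartedSpace E2 S]

/-- `φ t`, `0 ≤ t ≤ ε`, is a smooth family of coassociative submanifolds
(`dim = 4` and `Ω` restricts to zero) of `M`, with initial velocity the normal vector field `n`
of the first member `φ 0`. -/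
structure IsCoassociativeFamily (X : VectorCrossProduct M) (ε : ℝ) (φ : ℝ → C → M)
    (n : ∀ z : C, TangentSpace (𝓡 7) (φ 0 z)) : Prop where
  pos : 0 < ε
  smooth : ContMDiffOn (𝓘(ℝ, ℝ).prod (𝓡 4)) (𝓡 7) ∞ (fun q : ℝ × C => φ q.1 q.2)
    (Set.Icc 0 ε ×ˢ Set.univ)
  embeds : ∀ t ∈ Set.Icc 0 ε, EmbedsSubmanifold (𝓡 4) (𝓡 7) (φ t)
  coassociative : ∀ t ∈ Set.Icc 0 ε, ∀ (z : C) (u v w : TangentSpace (𝓡 4) z),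
    X.Omega (φ t z) (mfderiv (𝓡 4) (𝓡 7) (φ t) z u) (mfderiv (𝓡 4) (𝓡 7) (φ t) z v)
      (mfderiv (𝓡 4) (𝓡 7) (φ t) z w) = 0
  velocity : ∀ z : C,
    mfderivWithin 𝓘(ℝ, ℝ) (𝓡 7) (fun t => φ t z) (Set.Icc 0 ε) 0 (1 : ℝ) = n z
  normal_smooth : SmoothAlong (𝓡 4) (φ 0) n
  normal : ∀ z : C, n z ∈ (tangentOf (𝓡 4) (φ 0) z)ᗮ

/-- `J_n u = |n|⁻¹ n × u`, for a vector field `n` along `ι`. -/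
def Jn (X : VectorCrossProduct M) {ι : S → M} (n : ∀ x, TangentSpace (𝓡 7) (ι x)) (x : S) :
    TangentSpace (𝓡 7) (ι x) →L[ℝ] TangentSpace (𝓡 7) (ι x) :=
  ‖n x‖⁻¹ • X.cross (ι x) (n x)

/-- The inclusion in `M` of a curve `j` in the first member of the family `φ`. -/
abbrev curve (φ : ℝ → C → M) (j : S → C) : S → M := fun x => φ 0 (j x)

/-- `J_n` along the curve `j`. -/
abbrev curveJ (X : VectorCrossProduct M) (φ : ℝ → C → M)
    (n : ∀ z : C, TangentSpace (𝓡 7) (φ 0 z)) (j : S → C) (x : S) :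
    TangentSpace (𝓡 7) (curve φ j x) →L[ℝ] TangentSpace (𝓡 7) (curve φ j x) :=
  Jn X (ι := curve φ j) (fun y => n (j y)) x

/-- `j` is a `J_n`-holomorphic curve in `C = φ 0`: a two-dimensional submanifold whose tangent
spaces are preserved by `J_n`. -/
structure IsHolomorphicCurve (X : VectorCrossProduct M) (φ : ℝ → C → M)
    (n : ∀ z : C, TangentSpace (𝓡 7) (φ 0 z)) (j : S → C) : Prop where
  embeds : EmbedsSubmanifold (𝓡 2) (𝓡 4) j
  holomorphic : ∀ (x : S), ∀ u ∈ tangentOf (𝓡 2) (curve φ j) x,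
    curveJ X φ n j x u ∈ tangentOf (𝓡 2) (curve φ j) x

/-- The fibre at `x` of `N_{Σ/C}`: the orthogonal complement of `TΣ` in `TC`. -/
def normalInC (φ : ℝ → C → M) (j : S → C) (x : S) :
    Submodule ℝ (TangentSpace (𝓡 7) (curve φ j x)) :=
  tangentOf (𝓡 4) (φ 0) (j x) ⊓ (tangentOf (𝓡 2) (curve φ j) x)ᗮ

/-- The fibre at `x` of `N_{𝒞/M}|_Σ`: the orthogonal complement in `TM` of
`T𝒞 = TC ⊕ ℝ n`, where `𝒞 = ⋃ t, φ t` is swept out by the family. -/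
def normalOfSweep (φ : ℝ → C → M) (n : ∀ z : C, TangentSpace (𝓡 7) (φ 0 z)) (j : S → C) (x : S) :
    Submodule ℝ (TangentSpace (𝓡 7) (curve φ j x)) :=
  (tangentOf (𝓡 4) (φ 0) (j x) ⊔ Submodule.span ℝ {n (j x)})ᗮ

end Family

/-! ### Connections and Dirac operators along a surface `ι : S → M` -/

section Operators

variable {M : Type*} [TopologicalSpace M] [ChartedSpace E7 M] [IsManifold (𝓡 7) ∞ M]
  [RiemannianBundle (fun p : M => TangentSpace (𝓡 7) p)]
  {S : Type*} [TopologicalSpace S] [ChartedSpace E2 S] [IsManifold (𝓡 2) ∞ S]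

/-- The pull-back to `ι^* TM` of a connection on `TM`. If `V = ∑ Vᵃ e_a` in the local frame `e_a`
of `TM` given by the preferred trivialization at `ι x`, then
`∇_v V = ∑ dVᵃ(v) e_a + ∑ Vᵃ(x) ∇_{dι(v)} e_a`. -/
def alongDeriv (nabla : CovariantDerivative (𝓡 7) E7 (TangentSpace (𝓡 7) : M → Type _))
    (ι : S → M) (V : ∀ y, TangentSpace (𝓡 7) (ι y)) (x : S) (v : TangentSpace (𝓡 2) x) :
    TangentSpace (𝓡 7) (ι x) :=
  (trivializationAt E7 (TangentSpace (𝓡 7) : M → Type _) (ι x)).symm (ι x)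
      (mvfderiv (𝓡 2) (fun y => (trivializationAt E7 (TangentSpace (𝓡 7) : M → Type _) (ι x)
        (TotalSpace.mk' E7 (ι y) (V y))).2) x v)
    + nabla (FiberBundle.extend E7 (V x)) (ι x) (mfderiv (𝓡 2) (𝓡 7) ι x v)

/-- The induced connection `∇^L = π^L ∘ ∇` on a subbundle `L` of `TM|_Σ`. -/
def inducedDeriv (nabla : CovariantDerivative (𝓡 7) E7 (TangentSpace (𝓡 7) : M → Type _))
    (ι : S → M) (L : ∀ x, Submodule ℝ (TangentSpace (𝓡 7) (ι x)))
    (V : ∀ y, TangentSpace (𝓡 7) (ι y)) (x : S) (v : TangentSpace (𝓡 2) x) :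
    TangentSpace (𝓡 7) (ι x) :=
  (L x).starProjection (alongDeriv nabla ι V x v)

/-- The induced connection on `TΣ`, acting on tangent fields of the abstract surface. -/
def tangentDeriv (nabla : CovariantDerivative (𝓡 7) E7 (TangentSpace (𝓡 7) : M → Type _))
    (ι : S → M) (W : ∀ y : S, TangentSpace (𝓡 2) y) (x : S) (v : TangentSpace (𝓡 2) x) :
    TangentSpace (𝓡 2) x :=
  (mfderiv (𝓡 2) (𝓡 7) ι x).toLinearMap.leftInverse
    (inducedDeriv nabla ι (fun y : S => tangentOf (𝓡 2) ι y)
      (fun y : S => mfderiv (𝓡 2) (𝓡 7) ι y (W y)) x v)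

/-- An orthonormal basis of `T_x Σ` for the induced metric. Nothing below depends on its choice. -/
def frame (ι : S → M) (x : S) (i : Fin (Module.finrank ℝ (tangentOf (𝓡 2) ι x))) :
    TangentSpace (𝓡 2) x :=
  (mfderiv (𝓡 2) (𝓡 7) ι x).toLinearMap.leftInverse
    (stdOrthonormalBasis ℝ (tangentOf (𝓡 2) ι x) i : TangentSpace (𝓡 7) (ι x))

/-- `V` is a smooth section of the subbundle `L` of `TM|_Σ`. -/
def IsSection (ι : S → M) (L : ∀ x, Submodule ℝ (TangentSpace (𝓡 7) (ι x)))
    (V : ∀ y, TangentSpace (𝓡 7) (ι y)) : Prop :=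
  (∀ x, V x ∈ L x) ∧ SmoothAlong (𝓡 2) ι V

/-- The fibre at `x` of `Λ^{0,1}(L) = L ⊗_ℂ Λ^{0,1} T^*Σ`, where `L` is a complex line bundle in
`TM|_Σ` with complex structure `J`, and `TΣ` has the complex structure `J` too: the complex
antilinear maps `T_x Σ → L_x`. The tensor `s ⊗ α` is the map `w ↦ α(w) s`. -/
def Form01 (ι : S → M) (J : ∀ x, TangentSpace (𝓡 7) (ι x) →L[ℝ] TangentSpace (𝓡 7) (ι x))
    (L : ∀ x, Submodule ℝ (TangentSpace (𝓡 7) (ι x))) (x : S) :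
    Set (TangentSpace (𝓡 2) x →L[ℝ] TangentSpace (𝓡 7) (ι x)) :=
  {b | (∀ v, b v ∈ L x) ∧ ∀ v w, mfderiv (𝓡 2) (𝓡 7) ι x w = J x (mfderiv (𝓡 2) (𝓡 7) ι x v) →
    b w = - J x (b v)}

/-- `β` is a smooth section of `Λ^{0,1}(L)`; smoothness near `x` means that `β` has smooth values
on the local frame fields of `TΣ` given by the preferred trivialization at `x`. -/
def IsForm01Section (ι : S → M)
    (J : ∀ x, TangentSpace (𝓡 7) (ι x) →L[ℝ] TangentSpace (𝓡 7) (ι x))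
    (L : ∀ x, Submodule ℝ (TangentSpace (𝓡 7) (ι x)))
    (β : ∀ x, TangentSpace (𝓡 2) x →L[ℝ] TangentSpace (𝓡 7) (ι x)) : Prop :=
  (∀ x, β x ∈ Form01 ι J L x) ∧
  ∀ (x : S) (w : TangentSpace (𝓡 2) x),
    ContMDiffAt (𝓡 2) ((𝓡 7).prod 𝓘(ℝ, E7)) ∞
      (fun y => (TotalSpace.mk' E7 (ι y) (β y (FiberBundle.extend E2 w y)) :
        TangentBundle (𝓡 7) M)) x

/-- The tensor product connection on `Λ^{0,1}(L)` of the induced connections of `L` and `TΣ`: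
`(∇_v β)(w) = ∇^L_v (β(W)) - β(∇^{TΣ}_v W)` for a local field `W` with `W(x) = w`. -/
def formDeriv (nabla : CovariantDerivative (𝓡 7) E7 (TangentSpace (𝓡 7) : M → Type _))
    (ι : S → M) (L : ∀ x, Submodule ℝ (TangentSpace (𝓡 7) (ι x)))
    (β : ∀ x, TangentSpace (𝓡 2) x →L[ℝ] TangentSpace (𝓡 7) (ι x)) (x : S)
    (v w : TangentSpace (𝓡 2) x) : TangentSpace (𝓡 7) (ι x) :=
  inducedDeriv nabla ι L (fun y => β y (FiberBundle.extend E2 w y)) x v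
    - β x (tangentDeriv nabla ι (FiberBundle.extend E2 w) x v)

/-- Clifford multiplication `L → Λ^{0,1}(L)` of the Dolbeault complex,
`c(v) u = √2 (v^♭)^{0,1} ⊗ u`. Here `v^♭ = ⟨v, ·⟩` and, for a real covector `α`,
`α^{0,1}(w) = (α(w) + i α(J w)) / 2`. -/
def cliffordUp (ι : S → M) (J : ∀ x, TangentSpace (𝓡 7) (ι x) →L[ℝ] TangentSpace (𝓡 7) (ι x))
    (x : S) (v : TangentSpace (𝓡 2) x) (u : TangentSpace (𝓡 7) (ι x)) :
    TangentSpace (𝓡 2) x →L[ℝ] TangentSpace (𝓡 7) (ι x) :=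
  let dι := mfderiv (𝓡 2) (𝓡 7) ι x
  √2 • (2 : ℝ)⁻¹ • (((innerSL ℝ (dι v)).comp dι).smulRight u
    + ((innerSL ℝ (dι v)).comp ((J x).comp dι)).smulRight (J x u))

/-- Clifford multiplication `Λ^{0,1}(L) → L` of the Dolbeault complex: `√2` times minus the
contraction with `v^{0,1}`, which for an element `b` of `Λ^{0,1}(L)` is `b(v)`. -/
def cliffordDown (ι : S → M) (x : S) (v : TangentSpace (𝓡 2) x)
    (b : TangentSpace (𝓡 2) x → TangentSpace (𝓡 7) (ι x)) : TangentSpace (𝓡 7) (ι x) :=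
  -(√2 • b v)

/-- The component `L → Λ^{0,1}(L)` of the Dolbeault Dirac operator `∑ c(e_i) ∇_{e_i}`
on `L ⊕ Λ^{0,1}(L)`. -/
def dolbeaultUp (nabla : CovariantDerivative (𝓡 7) E7 (TangentSpace (𝓡 7) : M → Type _))
    (ι : S → M) (J : ∀ x, TangentSpace (𝓡 7) (ι x) →L[ℝ] TangentSpace (𝓡 7) (ι x))
    (L : ∀ x, Submodule ℝ (TangentSpace (𝓡 7) (ι x))) (u : ∀ y, TangentSpace (𝓡 7) (ι y)) (x : S) :
    TangentSpace (𝓡 2) x →L[ℝ] TangentSpace (𝓡 7) (ι x) :=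
  ∑ i, cliffordUp ι J x (frame ι x i) (inducedDeriv nabla ι L u x (frame ι x i))

/-- The component `Λ^{0,1}(L) → L` of the Dolbeault Dirac operator `∑ c(e_i) ∇_{e_i}`
on `L ⊕ Λ^{0,1}(L)`. -/
def dolbeaultDown (nabla : CovariantDerivative (𝓡 7) E7 (TangentSpace (𝓡 7) : M → Type _))
    (ι : S → M) (L : ∀ x, Submodule ℝ (TangentSpace (𝓡 7) (ι x)))
    (β : ∀ x, TangentSpace (𝓡 2) x →L[ℝ] TangentSpace (𝓡 7) (ι x)) (x : S) :
    TangentSpace (𝓡 7) (ι x) :=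
  ∑ i, cliffordDown ι x (frame ι x i) (formDeriv nabla ι L β x (frame ι x i))

/-- The Dolbeault Dirac operator on `L ⊕ Λ^{0,1}(L)`. -/
def dolbeaultDirac (nabla : CovariantDerivative (𝓡 7) E7 (TangentSpace (𝓡 7) : M → Type _))
    (ι : S → M) (J : ∀ x, TangentSpace (𝓡 7) (ι x) →L[ℝ] TangentSpace (𝓡 7) (ι x))
    (L : ∀ x, Submodule ℝ (TangentSpace (𝓡 7) (ι x)))
    (U : ∀ y, TangentSpace (𝓡 7) (ι y) × (TangentSpace (𝓡 2) y →L[ℝ] TangentSpace (𝓡 7) (ι y)))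
    (x : S) :
    TangentSpace (𝓡 7) (ι x) × (TangentSpace (𝓡 2) x →L[ℝ] TangentSpace (𝓡 7) (ι x)) :=
  (dolbeaultDown nabla ι L (fun y => (U y).2) x, dolbeaultUp nabla ι J L (fun y => (U y).1) x)

/-- The induced connection of the direct sum `L₁ ⊕ L₂` of two orthogonal subbundles of `TM|_Σ`:
the direct sum of the induced connections of `L₁` and `L₂`. -/
def sumDeriv (nabla : CovariantDerivative (𝓡 7) E7 (TangentSpace (𝓡 7) : M → Type _))
    (ι : S → M) (L₁ L₂ : ∀ x, Submodule ℝ (TangentSpace (𝓡 7) (ι x)))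
    (V : ∀ y, TangentSpace (𝓡 7) (ι y)) (x : S) (v : TangentSpace (𝓡 2) x) :
    TangentSpace (𝓡 7) (ι x) :=
  inducedDeriv nabla ι L₁ (fun y => (L₁ y).starProjection (V y)) x v
    + inducedDeriv nabla ι L₂ (fun y => (L₂ y).starProjection (V y)) x v

/-- The Dirac operator `∑ e_i × ∇_{e_i}` on `L₁ ⊕ L₂`, with `G₂` multiplication as Clifford
multiplication. -/
def g2Dirac (X : VectorCrossProduct M)
    (nabla : CovariantDerivative (𝓡 7) E7 (TangentSpace (𝓡 7) : M → Type _))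
    (ι : S → M) (L₁ L₂ : ∀ x, Submodule ℝ (TangentSpace (𝓡 7) (ι x)))
    (V : ∀ y, TangentSpace (𝓡 7) (ι y)) (x : S) : TangentSpace (𝓡 7) (ι x) :=
  ∑ i, X.cross (ι x) (mfderiv (𝓡 2) (𝓡 7) ι x (frame ι x i))
    (sumDeriv nabla ι L₁ L₂ V x (frame ι x i))

/-- The map `f : Λ^{0,1}(N_{Σ/C}) → N_{𝒞/M}|_Σ`, `f(b) = -(1/√2) ∑ b(e_i) × e_i`. For orthonormal
`e₂, e₃ = J e₂` and `Z = (e₂ - i e₃)/√2`, `Z̄^* = (e₂^* - i e₃^*)/√2`, it maps `s ⊗ Z̄^*` to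
`-(1/√2) s × Z`, where `s × (i e₃)` stands for `(J s) × e₃`. -/
def fMap (X : VectorCrossProduct M) (ι : S → M) (x : S)
    (b : TangentSpace (𝓡 2) x →L[ℝ] TangentSpace (𝓡 7) (ι x)) : TangentSpace (𝓡 7) (ι x) :=
  -((√2)⁻¹ • ∑ i, X.cross (ι x) (b (frame ι x i)) (mfderiv (𝓡 2) (𝓡 7) ι x (frame ι x i)))

/-- `Φ = id ⊕ f`, with values in `N_{Σ/C} ⊕ N_{𝒞/M}|_Σ ⊆ TM|_Σ`. -/
def phiMap (X : VectorCrossProduct M) (ι : S → M) (x : S)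
    (a : TangentSpace (𝓡 7) (ι x) × (TangentSpace (𝓡 2) x →L[ℝ] TangentSpace (𝓡 7) (ι x))) :
    TangentSpace (𝓡 7) (ι x) :=
  a.1 + fMap X ι x a.2

/-- `s ⊗ Z̄^*` with `Z̄^* = (e₂^* - i e₃^*)/√2`, where `e₂ = dι(v)` and `e₃ = dι(w)`. -/
def tensorZbar (ι : S → M) (J : ∀ x, TangentSpace (𝓡 7) (ι x) →L[ℝ] TangentSpace (𝓡 7) (ι x))
    (x : S) (v w : TangentSpace (𝓡 2) x) (s : TangentSpace (𝓡 7) (ι x)) :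
    TangentSpace (𝓡 2) x →L[ℝ] TangentSpace (𝓡 7) (ι x) :=
  let dι := mfderiv (𝓡 2) (𝓡 7) ι x
  (√2)⁻¹ • (((innerSL ℝ (dι v)).comp dι).smulRight s
    - ((innerSL ℝ (dι w)).comp dι).smulRight (J x s))

end Operators

end G2Dirac

end

/-!
The proof reduces the comparison of the two Dirac operators to linear algebra at a point and to one
application of the product rule.

*At a point* `x` of `Σ`, write `T ⊆ W` for the tangent spaces of `Σ` and of the coassociative
submanifold, `N₁ = W ⊓ Tᗮ` and `N₂ = (W ⊔ ℝ n)ᗮ` for the fibres of `N_{Σ/C}` and `N_{𝒞/M}`, and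
`J = |n|⁻¹ n ×` (`HolomorphicFlag`). The axioms of a cross product give
`u × (u × v) = ⟨u, v⟩ u - |u|² v`, hence `J² = -1` on the complement of `n`, and
`J (u × v) = -(J u) × v = -u × (J v)` when `u`, `v`, `n` are pairwise perpendicular. Since `Ω`
vanishes on `W`, a dimension count shows `Wᗮ × W ⊆ W` (`HolomorphicFlag.cross_mem`), and this gives
`T × N₁ ⊆ N₂`, `T × N₂ ⊆ N₁` and `N₂ × N₁ ⊆ T`. For an antilinear `b : T → N₁` the quadratic form
`v ↦ b(v) × v` is a multiple of the metric, so that `f(b) = -√2 b(v) × v` for every unit vector `v`.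
Consequently

* `v × f(b) = -√2 b(v)` (`HolomorphicFlag.cross_traceMap`), which shows that `f` is injective and
  tells what its inverse is, and
* `f(√2 (v^♭)^{0,1} ⊗ u) = v × u` (`HolomorphicFlag.traceMap_form`):

`f` intertwines the two Clifford multiplications.

*Along the curve*, the cross product is parallel for the pulled-back connection
(`alongDeriv_cross`), because `Ω` and the metric are parallel. Differentiating the identity
`e × f(β) = -√2 β(e)` for a tangent field `e` and projecting to `N₁` gives
`π^T(∇_v e) × f(β) + e × ∇^{N₂}_v f(β) = -√2 ∇^{N₁}_v (β(e))`, where the inclusions above identify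
the projections (`HolomorphicFlag.projection_cross_left`, `HolomorphicFlag.projection_cross_right`).
By the same identity the first term is `-√2 β(∇^{TΣ}_v e)`, so that
`e × ∇^{N₂}_v f(β) = -√2 (∇_v β)(e)` (`cross_inducedDeriv_fMap`). Summing over a frame gives the
component of the claim on `Λ^{0,1}(N_{Σ/C})`; the component on `N_{Σ/C}` is the second of the
pointwise identities.
-/

namespace G2Dirac

/-! ### Linear algebra of cross products -/

section CrossProduct

variable {V : Type*} [NormedAddCommGroup V] [InnerProductSpace ℝ V]

/-- A 2-fold vector cross product on a single Euclidean space `V`. -/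
structure IsCross (c : V →L[ℝ] V →L[ℝ] V) : Prop where
  skew : ∀ u v, c u v = -c v u
  perp_right : ∀ u v, inner ℝ (c u v) v = 0
  norm_sq : ∀ u v, ‖c u v‖ ^ 2 = ‖u‖ ^ 2 * ‖v‖ ^ 2 - (inner ℝ u v) ^ 2

namespace IsCross

variable {c : V →L[ℝ] V →L[ℝ] V} (hc : IsCross c)
include hc

theorem self (u : V) : c u u = 0 := by
  have h := hc.skew u u
  rwa [eq_neg_iff_add_eq_zero, ← two_smul ℝ, smul_eq_zero_iff_right two_ne_zero] at h

theorem inner_swap_right (u v w : V) : inner ℝ (c u v) w = -inner ℝ (c u w) v := by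
  have h := hc.perp_right u (v + w)
  simp only [map_add, inner_add_left, inner_add_right, hc.perp_right] at h
  linarith

theorem inner_rotate (u v w : V) : inner ℝ (c u v) w = inner ℝ (c v w) u := by
  rw [hc.skew u v, inner_neg_left, hc.inner_swap_right v u w, neg_neg]

theorem inner_cross_cross (u v w : V) :
    inner ℝ (c u v) (c u w) = ‖u‖ ^ 2 * inner ℝ v w - inner ℝ u v * inner ℝ u w := by
  have h := hc.norm_sq u (v + w)
  have h1 := hc.norm_sq u v
  have h2 := hc.norm_sq u w
  rw [map_add, norm_add_sq_real, norm_add_sq_real, inner_add_right] at h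
  linear_combination (h - h1 - h2) / 2

theorem cross_cross (u v : V) : c u (c u v) = inner ℝ u v • u - ‖u‖ ^ 2 • v := by
  refine ext_inner_right ℝ fun w => ?_
  rw [hc.inner_swap_right, hc.inner_cross_cross, inner_sub_left, real_inner_smul_left,
    real_inner_smul_left, real_inner_comm w v]
  ring

theorem cross_cross_add (u v w : V) :
    c u (c v w) + c v (c u w) = inner ℝ u w • v + inner ℝ v w • u - (2 * inner ℝ u v) • w := by
  have h := hc.cross_cross (u + v) w
  have h1 := hc.cross_cross u w
  have h2 := hc.cross_cross v w
  rw [norm_add_sq_real] at h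
  simp only [map_add, add_apply, inner_add_left] at h
  rw [h1, h2] at h
  linear_combination (norm := module) h

theorem cross_cross_anticomm {u v w : V} (huv : inner ℝ u v = 0) (huw : inner ℝ u w = 0)
    (hvw : inner ℝ v w = 0) : c u (c v w) = -c v (c u w) := by
  have h := hc.cross_cross_add u v w
  rw [huv, huw, hvw] at h
  simpa [add_eq_zero_iff_eq_neg] using h

end IsCross

/-- The endomorphism `u ↦ |n|⁻¹ n × u`, a complex structure on the complement of `n`. -/
noncomputable abbrev rotation (c : V →L[ℝ] V →L[ℝ] V) (n : V) : V →L[ℝ] V := ‖n‖⁻¹ • c n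

/-- A vector `n`, a coassociative 4-plane `W` perpendicular to it and a 2-plane `T ⊆ W` preserved by
`J = |n|⁻¹ n ×`, in a 7-dimensional Euclidean space with a cross product: the tangent spaces of a
`J_n`-holomorphic curve and of the coassociative submanifold around it. -/
structure HolomorphicFlag (c : V →L[ℝ] V →L[ℝ] V) (n : V) (W T : Submodule ℝ V) : Prop where
  isCross : IsCross c
  finrank_ambient : Module.finrank ℝ V = 7
  finrank_four : Module.finrank ℝ W = 4
  finrank_two : Module.finrank ℝ T = 2
  coassociative : ∀ u ∈ W, ∀ v ∈ W, ∀ w ∈ W, inner ℝ (c u v) w = 0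
  ne_zero : n ≠ 0
  normal : n ∈ Wᗮ
  le : T ≤ W
  holomorphic : ∀ u ∈ T, rotation c n u ∈ T

theorem mem_orthogonal_sup_span {W : Submodule ℝ V} {n g : V} :
    g ∈ (W ⊔ Submodule.span ℝ {n})ᗮ ↔ g ∈ Wᗮ ∧ inner ℝ n g = 0 := by
  rw [← Submodule.inf_orthogonal, Submodule.mem_inf,
    Submodule.mem_orthogonal_singleton_iff_inner_right]

namespace HolomorphicFlag

variable {c : V →L[ℝ] V →L[ℝ] V} {n : V} {W T : Submodule ℝ V} (h : HolomorphicFlag c n W T)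
include h

theorem finiteDimensional : FiniteDimensional ℝ V :=
  Module.finite_of_finrank_pos (by rw [h.finrank_ambient]; norm_num)

theorem cross_mem_orthogonal {u v : V} (hu : u ∈ W) (hv : v ∈ W) : c u v ∈ Wᗮ :=
  (Submodule.mem_orthogonal' _ _).2 fun w hw => h.coassociative u hu v hv w hw

/-- The normal 3-plane of a coassociative plane maps it to itself: for `0 ≠ w ∈ W`, a dimension
count shows that `v ↦ w × v` maps `W` onto `Wᗮ`, and `(w × v) × w` lies in `span {w, v}`. -/
theorem cross_mem {m w : V} (hm : m ∈ Wᗮ) (hw : w ∈ W) : c m w ∈ W := by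
  have := h.finiteDimensional
  rcases eq_or_ne w 0 with rfl | hw0
  · simp
  let g : W →ₗ[ℝ] Wᗮ := ((c w).toLinearMap.comp W.subtype).codRestrict Wᗮ
    fun v => h.cross_mem_orthogonal hw v.2
  have hg : ∀ v : W, (g v : V) = c w v := fun v => rfl
  have hker : LinearMap.ker g ≤ Submodule.span ℝ {(⟨w, hw⟩ : W)} := by
    intro v hv
    have h0 : c w (v : V) = 0 := by
      rw [← hg, LinearMap.mem_ker.1 hv]; rfl
    have h1 := h.isCross.cross_cross w v
    rw [h0, map_zero, eq_comm, sub_eq_zero] at h1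
    have hn : ‖w‖ ^ 2 ≠ 0 := by positivity
    refine Submodule.mem_span_singleton.2 ⟨(‖w‖ ^ 2)⁻¹ * inner ℝ w (v : V), Subtype.ext ?_⟩
    rw [Submodule.coe_smul, mul_smul]
    simp only
    rw [h1, inv_smul_smul₀ hn]
  have h1 : Module.finrank ℝ (LinearMap.ker g) ≤ 1 :=
    (Submodule.finrank_mono hker).trans ((finrank_span_le_card _).trans (by simp))
  have h2 := g.finrank_range_add_finrank_ker
  have h3 := W.finrank_add_finrank_orthogonal
  rw [h.finrank_four] at h2 h3
  rw [h.finrank_ambient] at h3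
  have htop : LinearMap.range g = ⊤ := by
    apply Submodule.eq_top_of_finrank_eq
    have := (LinearMap.range g).finrank_le
    omega
  obtain ⟨v, hv⟩ := LinearMap.range_eq_top.1 htop ⟨m, hm⟩
  have hv' : c w v = m := by rw [← hg, hv]
  rw [← hv', h.isCross.skew, h.isCross.cross_cross]
  exact neg_mem (sub_mem (W.smul_mem _ hw) (W.smul_mem _ v.2))


/-! ### The complex structure `|n|⁻¹ n ×` and the splitting of the ambient space -/

theorem inner_normal {u : V} (hu : u ∈ W) : inner ℝ n u = 0 :=
  (Submodule.mem_orthogonal' _ _).1 h.normal u hu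

theorem inner_rotation (u v : V) : inner ℝ (rotation c n u) v = -inner ℝ (rotation c n v) u := by
  simp only [smul_apply, real_inner_smul_left]
  rw [h.isCross.inner_swap_right]
  ring

theorem inner_rotation_self (u : V) : inner ℝ (rotation c n u) u = 0 := by
  have := h.inner_rotation u u
  linarith

theorem rotation_rotation {u : V} (hu : inner ℝ n u = 0) :
    rotation c n (rotation c n u) = -u := by
  have hn : ‖n‖ ≠ 0 := norm_ne_zero_iff.2 h.ne_zero
  simp only [smul_apply, map_smul]
  rw [h.isCross.cross_cross, hu, zero_smul, zero_sub, smul_neg, smul_neg, smul_smul, smul_smul]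
  rw [show ‖n‖⁻¹ * ‖n‖⁻¹ * ‖n‖ ^ 2 = 1 by field_simp, one_smul]

theorem norm_rotation_sq {u : V} (hu : inner ℝ n u = 0) : ‖rotation c n u‖ ^ 2 = ‖u‖ ^ 2 := by
  rw [← real_inner_self_eq_norm_sq, h.inner_rotation, h.rotation_rotation hu, inner_neg_left,
    neg_neg, real_inner_self_eq_norm_sq]

theorem cross_rotation_right {u v : V} (hu : inner ℝ n u = 0) (hv : inner ℝ n v = 0)
    (huv : inner ℝ u v = 0) : c u (rotation c n v) = -rotation c n (c u v) := by
  have hun : inner ℝ u n = 0 := by rw [real_inner_comm, hu]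
  simp only [smul_apply, map_smul]
  rw [h.isCross.cross_cross_anticomm hun huv hv, smul_neg]

theorem cross_rotation_left {u v : V} (hu : inner ℝ n u = 0) (hv : inner ℝ n v = 0)
    (huv : inner ℝ u v = 0) : c (rotation c n u) v = -rotation c n (c u v) := by
  have hvu : inner ℝ v u = 0 := by rw [real_inner_comm, huv]
  rw [h.isCross.skew, h.cross_rotation_right hv hu hvu, neg_neg, h.isCross.skew v u, map_neg]

theorem cross_self_rotation {u : V} (hu : inner ℝ n u = 0) :
    c u (rotation c n u) = (‖n‖⁻¹ * ‖u‖ ^ 2) • n := by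
  have hun : inner ℝ u n = 0 := by rw [real_inner_comm, hu]
  simp only [smul_apply, map_smul]
  rw [h.isCross.skew n u, map_neg, h.isCross.cross_cross, hun, zero_smul, zero_sub, neg_neg,
    smul_smul]

/-- A plane perpendicular to `n` and preserved by `J = |n|⁻¹ n ×` is the `J`-complex line through
any of its nonzero vectors. -/
theorem exists_eq_add_rotation {L : Submodule ℝ V} (hL : Module.finrank ℝ L = 2)
    (hJ : ∀ u ∈ L, rotation c n u ∈ L) (hn : ∀ u ∈ L, inner ℝ n u = 0) {u v : V} (hu : u ∈ L)
    (hu0 : u ≠ 0) (hv : v ∈ L) : ∃ a b : ℝ, v = a • u + b • rotation c n u := by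
  have := h.finiteDimensional
  have hli : LinearIndependent ℝ ![u, rotation c n u] := by
    rw [LinearIndependent.pair_iff]
    intro a b hab
    have hu2 : ‖u‖ ^ 2 ≠ 0 := by positivity
    have h1 : inner ℝ (a • u + b • rotation c n u) u = 0 := by rw [hab, inner_zero_left]
    have h2 : inner ℝ (a • u + b • rotation c n u) (rotation c n u) = 0 := by
      rw [hab, inner_zero_left]
    rw [inner_add_left, real_inner_smul_left, real_inner_smul_left, h.inner_rotation_self,
      real_inner_self_eq_norm_sq] at h1
    rw [inner_add_left, real_inner_smul_left, real_inner_smul_left,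
      real_inner_comm (rotation c n u) u, h.inner_rotation_self,
      real_inner_self_eq_norm_sq, h.norm_rotation_sq (hn u hu)] at h2
    constructor
    · simpa [hu2, hu0] using h1
    · simpa [hu2, hu0] using h2
  have hle : Submodule.span ℝ {u, rotation c n u} ≤ L := by
    rw [Submodule.span_le]
    rintro x (rfl | rfl)
    · exact hu
    · exact hJ _ hu
  have hfr : Module.finrank ℝ (Submodule.span ℝ {u, rotation c n u}) = 2 := by
    have := finrank_span_eq_card hli
    rwa [Matrix.range_cons, Matrix.range_cons, Matrix.range_empty, Set.union_empty,
      Set.singleton_union, Fintype.card_fin] at this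
  have heq := Submodule.eq_of_le_of_finrank_eq hle (hfr.trans hL.symm)
  rw [← heq, Submodule.mem_span_pair] at hv
  obtain ⟨a, b, hab⟩ := hv
  exact ⟨a, b, hab.symm⟩

theorem cross_eq_smul_normal {L : Submodule ℝ V} (hL : Module.finrank ℝ L = 2)
    (hJ : ∀ u ∈ L, rotation c n u ∈ L) (hn : ∀ u ∈ L, inner ℝ n u = 0) {u v : V} (hu : u ∈ L)
    (hv : v ∈ L) : ∃ r : ℝ, c u v = r • n := by
  rcases eq_or_ne u 0 with rfl | hu0
  · exact ⟨0, by simp⟩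
  obtain ⟨a, b, rfl⟩ := h.exists_eq_add_rotation hL hJ hn hu hu0 hv
  refine ⟨b * (‖n‖⁻¹ * ‖u‖ ^ 2), ?_⟩
  rw [map_add, map_smul, map_smul, h.isCross.self, h.cross_self_rotation (hn u hu), smul_zero,
    zero_add, smul_smul]

theorem inner_normal_of_mem {u : V} (hu : u ∈ T) : inner ℝ n u = 0 := h.inner_normal (h.le hu)

theorem rotation_mem_normalInC {s : V} (hs : s ∈ W ⊓ Tᗮ) : rotation c n s ∈ W ⊓ Tᗮ := by
  refine ⟨W.smul_mem _ (h.cross_mem h.normal hs.1), (Submodule.mem_orthogonal' _ _).2 fun t ht => ?_⟩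
  rw [h.inner_rotation, (Submodule.mem_orthogonal _ _).1 hs.2 _ (h.holomorphic t ht), neg_zero]

theorem finrank_normalInC : Module.finrank ℝ (W ⊓ Tᗮ : Submodule ℝ V) = 2 := by
  have := h.finiteDimensional
  have h1 := Submodule.finrank_add_inf_finrank_orthogonal h.le
  rw [h.finrank_two, h.finrank_four, inf_comm] at h1
  omega

/-- `TΣ × N_{Σ/C} ⊆ N_{𝒞/M}`. -/
theorem cross_mem_normalOfSweep {t s : V} (ht : t ∈ T) (hs : s ∈ W ⊓ Tᗮ) :
    c t s ∈ (W ⊔ Submodule.span ℝ {n})ᗮ := by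
  refine mem_orthogonal_sup_span.2 ⟨h.cross_mem_orthogonal (h.le ht) hs.1, ?_⟩
  have h1 := (Submodule.mem_orthogonal _ _).1 hs.2 _ (h.holomorphic t ht)
  have hn : ‖n‖⁻¹ ≠ 0 := inv_ne_zero (norm_ne_zero_iff.2 h.ne_zero)
  rw [smul_apply, real_inner_smul_left] at h1
  rw [real_inner_comm, ← h.isCross.inner_rotate n t s]
  exact (mul_eq_zero.1 h1).resolve_left hn

/-- `TΣ × N_{𝒞/M} ⊆ N_{Σ/C}`. -/
theorem cross_mem_normalInC {t g : V} (ht : t ∈ T) (hg : g ∈ (W ⊔ Submodule.span ℝ {n})ᗮ) :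
    c t g ∈ W ⊓ Tᗮ := by
  rw [mem_orthogonal_sup_span] at hg
  refine ⟨?_, (Submodule.mem_orthogonal' _ _).2 fun t' ht' => ?_⟩
  · rw [h.isCross.skew]
    exact neg_mem (h.cross_mem hg.1 (h.le ht))
  · obtain ⟨r, hr⟩ := h.cross_eq_smul_normal h.finrank_two h.holomorphic
      (fun u hu => h.inner_normal_of_mem hu) ht ht'
    rw [h.isCross.inner_swap_right, hr, real_inner_smul_left, hg.2, mul_zero, neg_zero]

/-- `N_{𝒞/M} × N_{Σ/C} ⊆ TΣ`. -/
theorem cross_mem_tangent {g s : V} (hg : g ∈ (W ⊔ Submodule.span ℝ {n})ᗮ) (hs : s ∈ W ⊓ Tᗮ) :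
    c g s ∈ T := by
  have := h.finiteDimensional
  rw [mem_orthogonal_sup_span] at hg
  have hW : c g s ∈ W := h.cross_mem hg.1 hs.1
  have hN : c g s ∈ (W ⊓ Tᗮ)ᗮ := (Submodule.mem_orthogonal' _ _).2 fun s' hs' => by
    obtain ⟨r, hr⟩ := h.cross_eq_smul_normal h.finrank_normalInC
      (fun u hu => h.rotation_mem_normalInC hu) (fun u hu => h.inner_normal hu.1) hs hs'
    rw [h.isCross.inner_rotate, hr, real_inner_smul_left, hg.2, mul_zero]
  rw [sub_eq_zero.1 ((Submodule.eq_bot_iff _).1 (W ⊓ Tᗮ).inf_orthogonal_eq_bot _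
    ⟨⟨sub_mem hW (h.le (T.starProjection_apply_mem (c g s))),
      Submodule.sub_starProjection_mem_orthogonal _⟩,
      sub_mem hN ((Submodule.mem_orthogonal' _ _).2 fun s' hs' =>
        (Submodule.mem_orthogonal _ _).1 hs'.2 _ (T.starProjection_apply_mem (c g s)))⟩)]
  exact T.starProjection_apply_mem _

/-- In `∇s × g` only the tangential part of `∇s` contributes to the `N_{Σ/C}`-component, if
`g ∈ N_{𝒞/M}`. -/
theorem projection_cross_left (a : V) {g : V} (hg : g ∈ (W ⊔ Submodule.span ℝ {n})ᗮ)
    [(W ⊓ Tᗮ).HasOrthogonalProjection] [T.HasOrthogonalProjection] :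
    (W ⊓ Tᗮ).starProjection (c a g) = c (T.starProjection a) g := by
  refine Submodule.eq_starProjection_of_mem_of_inner_eq_zero
    (h.cross_mem_normalInC (T.starProjection_apply_mem a) hg) fun s hs => ?_
  rw [← sub_apply, ← map_sub, h.isCross.inner_rotate]
  exact (Submodule.mem_orthogonal _ _).1 (Submodule.sub_starProjection_mem_orthogonal a) _
    (h.cross_mem_tangent hg hs)

/-- In `e × ∇g` only the `N_{𝒞/M}`-part of `∇g` contributes to the `N_{Σ/C}`-component, if
`e` is tangential. -/
theorem projection_cross_right (a : V) {e : V} (he : e ∈ T)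
    [(W ⊓ Tᗮ).HasOrthogonalProjection]
    [((W ⊔ Submodule.span ℝ {n})ᗮ).HasOrthogonalProjection] :
    (W ⊓ Tᗮ).starProjection (c e a)
      = c e (((W ⊔ Submodule.span ℝ {n})ᗮ).starProjection a) := by
  refine Submodule.eq_starProjection_of_mem_of_inner_eq_zero
    (h.cross_mem_normalInC he (Submodule.starProjection_apply_mem _ a)) fun s hs => ?_
  rw [← map_sub, h.isCross.inner_swap_right, (Submodule.mem_orthogonal _ _).1
    (Submodule.sub_starProjection_mem_orthogonal a) _ (h.cross_mem_normalOfSweep he hs), neg_zero]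

end HolomorphicFlag

end CrossProduct

/-! ### The map `f` on a single fibre -/

section Fibre

variable {V : Type*} [NormedAddCommGroup V] [InnerProductSpace ℝ V]
  {E : Type*} [AddCommGroup E] [Module ℝ E] [TopologicalSpace E]

/-- The fibre of `Λ^{0,1}(N_{Σ/C})`, for the flag `T ⊆ W` and the parametrization `d` of `T`: the
maps with values in `W ⊓ Tᗮ` that are antilinear for `J = |n|⁻¹ n ×`. -/
def formFibre (c : V →L[ℝ] V →L[ℝ] V) (n : V) (W T : Submodule ℝ V) (d : E →L[ℝ] V) :
    Set (E →L[ℝ] V) :=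
  {b | (∀ v, b v ∈ W ⊓ Tᗮ) ∧ ∀ v w, d w = rotation c n (d v) → b w = -rotation c n (b v)}

/-- The map `f(b) = -(1/√2) ∑ b(e_i) × e_i`, for vectors `e_i` given through the parametrization
`d`. -/
noncomputable def traceMap {I : Type*} [Fintype I] (c : V →L[ℝ] V →L[ℝ] V) (d : E →L[ℝ] V)
    (e : I → E) (b : E →L[ℝ] V) : V :=
  -((√2)⁻¹ • ∑ i, c (b (e i)) (d (e i)))

variable {c : V →L[ℝ] V →L[ℝ] V} {n : V} {W T : Submodule ℝ V}
  (h : HolomorphicFlag c n W T) {d : E →L[ℝ] V} (hinj : Function.Injective d)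
  (hrange : ∀ t, t ∈ T ↔ ∃ v, d v = t)
  {I : Type*} [Fintype I] {e : I → E} (hcard : Fintype.card I = 2) (he : ∀ i, ‖d (e i)‖ = 1)

theorem inner_normalInC_tangent {s t : V} (hs : s ∈ W ⊓ Tᗮ) (ht : t ∈ T) : inner ℝ s t = 0 :=
  (Submodule.mem_orthogonal' _ _).1 hs.2 t ht

theorem traceMap_sum {K : Type*} [Fintype K] (c : V →L[ℝ] V →L[ℝ] V) (d : E →L[ℝ] V) (e : I → E)
    (b : K → E →L[ℝ] V) : traceMap c d e (∑ k, b k) = ∑ k, traceMap c d e (b k) := by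
  simp only [traceMap, sum_apply, map_sum]
  rw [Finset.sum_comm, Finset.smul_sum, Finset.sum_neg_distrib]

namespace HolomorphicFlag

include h

theorem cross_rotation_rotation {s t : V} (hs : s ∈ W ⊓ Tᗮ) (ht : t ∈ T) :
    c (rotation c n s) (rotation c n t) = -c s t := by
  rw [h.cross_rotation_left (h.inner_normal hs.1) (h.inner_normal_of_mem (h.holomorphic t ht))
    (inner_normalInC_tangent hs (h.holomorphic t ht)),
    h.cross_rotation_right (h.inner_normal hs.1) (h.inner_normal_of_mem ht)
    (inner_normalInC_tangent hs ht), map_neg, neg_neg, h.rotation_rotation]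
  have := mem_orthogonal_sup_span.1 (h.cross_mem_normalOfSweep ht hs)
  rw [h.isCross.skew, inner_neg_right, this.2, neg_zero]

include hrange

theorem traceMap_mem {b : E →L[ℝ] V} (hb : b ∈ formFibre c n W T d) :
    traceMap c d e b ∈ (W ⊔ Submodule.span ℝ {n})ᗮ := by
  refine neg_mem (Submodule.smul_mem _ _ (sum_mem fun i _ => ?_))
  rw [h.isCross.skew]
  exact neg_mem (h.cross_mem_normalOfSweep ((hrange _).2 ⟨_, rfl⟩) (hb.1 _))

theorem traceMap_rotation_comp {b : E →L[ℝ] V} (hb : b ∈ formFibre c n W T d) :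
    traceMap c d e ((rotation c n).comp b) = -rotation c n (traceMap c d e b) := by
  have : ∀ i, c (((rotation c n).comp b) (e i)) (d (e i))
      = -rotation c n (c (b (e i)) (d (e i))) := fun i => by
    have hdv : d (e i) ∈ T := (hrange _).2 ⟨_, rfl⟩
    rw [ContinuousLinearMap.comp_apply, h.cross_rotation_left (h.inner_normal (hb.1 _).1)
      (h.inner_normal_of_mem hdv) (inner_normalInC_tangent (hb.1 _) hdv)]
  rw [traceMap, traceMap, Finset.sum_congr rfl fun i _ => this i, Finset.sum_neg_distrib,
    ← map_sum, map_neg, map_smul, smul_neg]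

/-- The `(0,1)`-part of the covector `⟨v, ·⟩`, tensored with `s`, is antilinear. -/
theorem mem_formFibre {v : E} {s : V} (hs : s ∈ W ⊓ Tᗮ) {r : ℝ} {b : E →L[ℝ] V}
    (hb : ∀ w, b w = r • (inner ℝ (d v) (d w) • s
      + inner ℝ (d v) (rotation c n (d w)) • rotation c n s)) :
    b ∈ formFibre c n W T d := by
  refine ⟨fun w => ?_, fun w w' hw' => ?_⟩
  · rw [hb]
    exact Submodule.smul_mem _ _ (add_mem (Submodule.smul_mem _ _ hs)
      (Submodule.smul_mem _ _ (h.rotation_mem_normalInC hs)))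
  · rw [hb, hb, hw', h.rotation_rotation (h.inner_normal_of_mem ((hrange _).2 ⟨w, rfl⟩))]
    simp only [map_smul (rotation c n), map_add (rotation c n)]
    rw [h.rotation_rotation (h.inner_normal hs.1), inner_neg_right]
    module

include hinj

/-- The quadratic form `v ↦ b(v) × v` of an antilinear `b` is a multiple of the metric. -/
theorem cross_apply_self {b : E →L[ℝ] V} (hb : b ∈ formFibre c n W T d) {v : E} (hv : d v ≠ 0)
    (w : E) : c (b w) (d w) = (‖d w‖ ^ 2 / ‖d v‖ ^ 2) • c (b v) (d v) := by
  have hdv : d v ∈ T := (hrange _).2 ⟨v, rfl⟩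
  obtain ⟨a, r, hw⟩ := h.exists_eq_add_rotation h.finrank_two h.holomorphic
    (fun u hu => h.inner_normal_of_mem hu) hdv hv ((hrange _).2 ⟨w, rfl⟩)
  obtain ⟨v', hv'⟩ := (hrange _).1 (h.holomorphic _ hdv)
  have hw' : w = a • v + r • v' := hinj (by rw [hw, map_add, map_smul, map_smul, hv'])
  have hbv' : b v' = -rotation c n (b v) := hb.2 v v' hv'
  have hbw : b w = a • b v - r • rotation c n (b v) := by
    rw [hw', map_add, map_smul, map_smul, hbv', smul_neg, sub_eq_add_neg]
  have hs := hb.1 v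
  have h1 := h.cross_rotation_rotation hs hdv
  have h2 : c (rotation c n (b v)) (d v) = c (b v) (rotation c n (d v)) := by
    rw [h.cross_rotation_left (h.inner_normal hs.1) (h.inner_normal_of_mem hdv)
      (inner_normalInC_tangent hs hdv),
      h.cross_rotation_right (h.inner_normal hs.1) (h.inner_normal_of_mem hdv)
      (inner_normalInC_tangent hs hdv)]
  have h3 : ‖d w‖ ^ 2 = (a ^ 2 + r ^ 2) * ‖d v‖ ^ 2 := by
    rw [hw, norm_add_sq_real, real_inner_smul_left, real_inner_smul_right,
      real_inner_comm (rotation c n (d v)), h.inner_rotation_self, norm_smul, norm_smul, mul_pow,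
      mul_pow, h.norm_rotation_sq (h.inner_normal_of_mem hdv), Real.norm_eq_abs, Real.norm_eq_abs,
      sq_abs, sq_abs]
    ring
  have hne : ‖d v‖ ^ 2 ≠ 0 := by positivity
  rw [h3, mul_div_assoc, div_self hne, mul_one, hbw, hw]
  generalize rotation c n (d v) = y at h1 h2 ⊢
  generalize rotation c n (b v) = z at h1 h2 ⊢
  simp only [map_add, map_sub, sub_apply, map_smul, smul_apply]
  rw [h1, h2]
  module

include hcard he

/-- The sum over a frame in `f(b)` may be evaluated on a single nonzero vector, since `v ↦ b(v) × v`
is a multiple of the metric. -/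
theorem traceMap_eq {b : E →L[ℝ] V} (hb : b ∈ formFibre c n W T d) {v : E} (hv : d v ≠ 0) :
    traceMap c d e b = -((√2 * (‖d v‖ ^ 2)⁻¹) • c (b v) (d v)) := by
  have hs : (√2)⁻¹ * 2 = √2 := by
    have : √2 * √2 = 2 := Real.mul_self_sqrt (by norm_num)
    field_simp
    linarith
  rw [traceMap, Finset.sum_congr rfl fun i _ => h.cross_apply_self hinj hrange hb hv (e i)]
  simp only [he, one_pow, one_div, Finset.sum_const, Finset.card_univ, hcard]
  rw [← Nat.cast_smul_eq_nsmul ℝ, smul_smul, smul_smul]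
  push_cast
  rw [hs]

/-- `v × f(b) = -√2 b(v)`: the map `f` intertwines the two Clifford multiplications. -/
theorem cross_traceMap {b : E →L[ℝ] V} (hb : b ∈ formFibre c n W T d) (v : E) :
    c (d v) (traceMap c d e b) = -(√2 • b v) := by
  rcases eq_or_ne (d v) 0 with hv | hv
  · have : v = 0 := hinj (by rw [hv, map_zero])
    simp [this]
  have hne : ‖d v‖ ^ 2 ≠ 0 := by positivity
  rw [h.traceMap_eq hinj hrange hcard he hb hv, map_neg, map_smul, h.isCross.skew (b v), map_neg,
    h.isCross.cross_cross, real_inner_comm,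
    inner_normalInC_tangent (hb.1 v) ((hrange _).2 ⟨v, rfl⟩), zero_smul, zero_sub, neg_neg,
    smul_smul, mul_assoc, inv_mul_cancel₀ hne, mul_one]

theorem traceMap_bijOn :
    Set.BijOn (traceMap c d e) (formFibre c n W T d)
      ((W ⊔ Submodule.span ℝ {n})ᗮ : Submodule ℝ V) := by
  have h2 : √2 ≠ 0 := by positivity
  refine ⟨fun b hb => h.traceMap_mem hrange hb, fun b hb b' hb' hbb' => ?_,
    fun g hg => ?_⟩
  · ext v
    have h1 := h.cross_traceMap hinj hrange hcard he hb v
    rw [hbb', h.cross_traceMap hinj hrange hcard he hb' v] at h1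
    exact (smul_right_injective V h2 (neg_injective h1)).symm
  · -- The relation `v × f(b) = -√2 b(v)` leaves no choice for the preimage.
    have hmem : -((√2)⁻¹ • (c.flip g).comp d) ∈ formFibre c n W T d := by
      refine ⟨fun v => ?_, fun v w hw => ?_⟩
      · exact neg_mem (Submodule.smul_mem _ _ (h.cross_mem_normalInC ((hrange _).2 ⟨v, rfl⟩) hg))
      · have hdv : d v ∈ T := (hrange _).2 ⟨v, rfl⟩
        have hg' := mem_orthogonal_sup_span.1 hg
        have := h.cross_rotation_left (h.inner_normal_of_mem hdv) hg'.2
          ((Submodule.mem_orthogonal _ _).1 hg'.1 _ (h.le hdv))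
        change -((√2)⁻¹ • c (d w) g) = -rotation c n (-((√2)⁻¹ • c (d v) g))
        rw [hw, this, map_neg, map_smul, smul_neg]
    refine ⟨_, hmem, ?_⟩
    obtain ⟨i⟩ : Nonempty I := Fintype.card_pos_iff.1 (by omega)
    have hi : d (e i) ≠ 0 := norm_ne_zero_iff.1 (by rw [he]; norm_num)
    rw [h.traceMap_eq hinj hrange hcard he hmem hi]
    have hg' := mem_orthogonal_sup_span.1 hg
    have h0 : inner ℝ (d (e i)) g = 0 :=
      (Submodule.mem_orthogonal _ _).1 hg'.1 _ (h.le ((hrange _).2 ⟨_, rfl⟩))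
    simp only [neg_apply, smul_apply, ContinuousLinearMap.comp_apply,
      ContinuousLinearMap.flip_apply, map_neg, map_smul, he]
    rw [h.isCross.skew, h.isCross.cross_cross, h0, he]
    simp only [zero_smul, zero_sub, one_pow, one_smul, inv_one, mul_one, neg_neg, smul_neg]
    rw [smul_smul, mul_inv_cancel₀ h2, one_smul]

/-- `f(√2 (v^♭)^{0,1} ⊗ s) = v × s` for a unit vector `v` (the case `r = 1/√2`): the map `f`
intertwines the Clifford multiplications on `N_{Σ/C}`. -/
theorem traceMap_form {v : E} (hv : ‖d v‖ = 1) {s : V} (hs : s ∈ W ⊓ Tᗮ) {r : ℝ} {b : E →L[ℝ] V}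
    (hb : ∀ w, b w = r • (inner ℝ (d v) (d w) • s
      + inner ℝ (d v) (rotation c n (d w)) • rotation c n s)) :
    traceMap c d e b = (√2 * r) • c (d v) s := by
  have hv0 : d v ≠ 0 := norm_ne_zero_iff.1 (by rw [hv]; norm_num)
  rw [h.traceMap_eq hinj hrange hcard he (h.mem_formFibre hrange hs hb) hv0, hb, hv,
    real_inner_self_eq_norm_sq, hv, real_inner_comm, h.inner_rotation_self]
  simp only [zero_smul, add_zero, one_pow, inv_one, mul_one, one_smul, map_smul, smul_apply]
  rw [smul_smul, ← smul_neg, ← h.isCross.skew]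

end HolomorphicFlag

end Fibre

/-! ### Derivatives of vector-valued maps on manifolds -/

section Calculus

variable {E H N : Type*} [NormedAddCommGroup E] [NormedSpace ℝ E] [TopologicalSpace H]
  {I : ModelWithCorners ℝ E H} [TopologicalSpace N] [ChartedSpace H N]
  {E' H' N' : Type*} [NormedAddCommGroup E'] [NormedSpace ℝ E'] [TopologicalSpace H']
  {I' : ModelWithCorners ℝ E' H'} [TopologicalSpace N'] [ChartedSpace H' N']
  {F F' : Type*} [NormedAddCommGroup F] [NormedSpace ℝ F] [NormedAddCommGroup F']
  [NormedSpace ℝ F']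

theorem mvfderiv_congr {f g : N → F} {x : N} (h : f =ᶠ[nhds x] g) :
    mvfderiv I f x = mvfderiv I g x := by
  ext v
  exact congrArg (fun L : E →L[ℝ] F => L v) h.mfderiv_eq

theorem mvfderiv_clm_apply {g : N → F →L[ℝ] F'} {f : N → F} {x : N}
    (hg : MDifferentiableAt I 𝓘(ℝ, F →L[ℝ] F') g x) (hf : MDifferentiableAt I 𝓘(ℝ, F) f x)
    (v : TangentSpace I x) :
    mvfderiv I (fun y => g y (f y)) x v = mvfderiv I g x v (f x) + g x (mvfderiv I f x v) := by
  have hu : UniqueDiffWithinAt ℝ (Set.range I) (extChartAt I x x) :=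
    I.uniqueDiffOn _ (Set.mem_range_self _)
  have h := fderivWithin_clm_apply hu ((mdifferentiableAt_iff _ _).1 hg).2
    ((mdifferentiableAt_iff _ _).1 hf).2
  have e : writtenInExtChartAt I 𝓘(ℝ, F') x (fun y => g y (f y)) = fun z =>
      (writtenInExtChartAt I 𝓘(ℝ, F →L[ℝ] F') x g z) (writtenInExtChartAt I 𝓘(ℝ, F) x f z) := rfl
  rw [(hg.clm_apply hf).mvfderiv, hg.mvfderiv, hf.mvfderiv, e, h, add_comm]
  have e1 : writtenInExtChartAt I 𝓘(ℝ, F →L[ℝ] F') x g (extChartAt I x x) = g x := by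
    simp [writtenInExtChartAt, chartAt_self_eq]
  have e2 : writtenInExtChartAt I 𝓘(ℝ, F) x f (extChartAt I x x) = f x := by
    simp [writtenInExtChartAt, chartAt_self_eq]
  rw [e1, e2]
  rfl

theorem mvfderiv_comp_vector {g : N' → F} {f : N → N'} {x : N}
    (hg : MDifferentiableAt I' 𝓘(ℝ, F) g (f x)) (hf : MDifferentiableAt I I' f x)
    (v : TangentSpace I x) :
    mvfderiv I (fun y => g (f y)) x v = mvfderiv I' g (f x) (mfderiv I I' f x v) :=
  mfderiv_comp_apply x hg hf v

theorem mvfderiv_clm_comp (L : F →L[ℝ] F') {f : N → F} {x : N}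
    (hf : MDifferentiableAt I 𝓘(ℝ, F) f x) (v : TangentSpace I x) :
    mvfderiv I (fun y => L (f y)) x v = L (mvfderiv I f x v) := by
  rw [mvfderiv_clm_apply mdifferentiableAt_const hf, mvfderiv_const]
  simp

end Calculus

/-! ### The product rule for the cross product -/

section Connection

variable {M : Type*} [TopologicalSpace M] [ChartedSpace E7 M] [IsManifold (𝓡 7) ∞ M]

/-- The coordinates of a tangent vector in the preferred trivialization at `p`. -/
noncomputable abbrev coord (p q : M) (w : TangentSpace (𝓡 7) q) : E7 :=
  (trivializationAt E7 (TangentSpace (𝓡 7) : M → Type _) p (TotalSpace.mk' E7 q w)).2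

theorem eventually_mem_baseSet (p : M) : ∀ᶠ q in nhds p,
    q ∈ (trivializationAt E7 (TangentSpace (𝓡 7) : M → Type _) p).baseSet :=
  (trivializationAt E7 (TangentSpace (𝓡 7) : M → Type _) p).open_baseSet.mem_nhds
    (FiberBundle.mem_baseSet_trivializationAt' p)

theorem mdifferentiableAt_coord {E H N : Type*} [NormedAddCommGroup E] [NormedSpace ℝ E]
    [TopologicalSpace H] {I : ModelWithCorners ℝ E H} [TopologicalSpace N] [ChartedSpace H N]
    {ι : N → M} {V : ∀ y, TangentSpace (𝓡 7) (ι y)} {x : N}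
    (hV : MDifferentiableAt I ((𝓡 7).prod 𝓘(ℝ, E7)) (fun y => TotalSpace.mk' E7 (ι y) (V y)) x) :
    MDifferentiableAt I 𝓘(ℝ, E7) (fun y => coord (ι x) (ι y) (V y)) x :=
  ((mdifferentiableAt_totalSpace (𝓡 7) _).1 hV).2

theorem mvfderiv_coord_extend (p : M) (a : TangentSpace (𝓡 7) p) :
    mvfderiv (𝓡 7) (fun q => coord p q (FiberBundle.extend E7 a q)) p = 0 := by
  have e : (fun q => coord p q (FiberBundle.extend E7 a q)) =ᶠ[nhds p] fun _ => coord p p a := by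
    filter_upwards [eventually_mem_baseSet p] with q hq
    have h := congrArg Prod.snd (Trivialization.apply_mk_symm _ hq (coord p p a))
    exact h
  rw [mvfderiv_congr e, mvfderiv_const]

theorem symm_coord (p : M) (a : TangentSpace (𝓡 7) p) :
    (trivializationAt E7 (TangentSpace (𝓡 7) : M → Type _) p).symm p (coord p p a) = a :=
  Trivialization.symm_apply_apply_mk _ (FiberBundle.mem_baseSet_trivializationAt' p) _

theorem isLinearMap_symm {p q : M}
    (hq : q ∈ (trivializationAt E7 (TangentSpace (𝓡 7) : M → Type _) p).baseSet) :
    IsLinearMap ℝ ((trivializationAt E7 (TangentSpace (𝓡 7) : M → Type _) p).symm q) := by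
  have h : ∀ a, (trivializationAt E7 (TangentSpace (𝓡 7) : M → Type _) p).symmL ℝ q a = _ :=
    fun a => Trivialization.symmL_apply _ hq a
  exact ⟨fun a b => by rw [← h, ← h, ← h, map_add], fun r a => by rw [← h, ← h, map_smul]⟩

/-- The local formula `∇_u Y = ∑ dYᵃ(u) e_a + ∑ Yᵃ(p) ∇_u e_a` in the frame `e_a` given by the
preferred trivialization at `p`: the difference of `∇` and the derivative of coordinates is
tensorial. -/
theorem nabla_eq (nabla : CovariantDerivative (𝓡 7) E7 (TangentSpace (𝓡 7) : M → Type _))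
    {Y : ∀ q : M, TangentSpace (𝓡 7) q} {p : M}
    (hY : MDifferentiableAt (𝓡 7) ((𝓡 7).prod 𝓘(ℝ, E7)) (fun q => TotalSpace.mk' E7 q (Y q)) p)
    (u : TangentSpace (𝓡 7) p) :
    nabla Y p u = (trivializationAt E7 (TangentSpace (𝓡 7) : M → Type _) p).symm p
        (mvfderiv (𝓡 7) (fun q => coord p q (Y q)) p u)
      + nabla (FiberBundle.extend E7 (Y p)) p u := by
  have hp := FiberBundle.mem_baseSet_trivializationAt' (F := E7)
    (E := (TangentSpace (𝓡 7) : M → Type _)) p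
  have hsymm : ∀ a, (trivializationAt E7 (TangentSpace (𝓡 7) : M → Type _) p).symm p a
      = (trivializationAt E7 (TangentSpace (𝓡 7) : M → Type _) p).symmL ℝ p a := fun a =>
    (Trivialization.symmL_apply _ hp a).symm
  have htens : TensorialAt (𝓡 7) E7 (fun Y : (∀ q : M, TangentSpace (𝓡 7) q) =>
      nabla Y p u - (trivializationAt E7 (TangentSpace (𝓡 7) : M → Type _) p).symmL ℝ p
        (mvfderiv (𝓡 7) (fun q => coord p q (Y q)) p u)) p := by
    refine ⟨fun {f σ} hf hσ => ?_, fun {σ σ'} hσ hσ' => ?_⟩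
    · have hc := mdifferentiableAt_coord hσ
      have e : (fun q => coord p q ((f • σ) q)) =ᶠ[nhds p] f • fun q => coord p q (σ q) := by
        filter_upwards [eventually_mem_baseSet p] with q hq
        exact ((trivializationAt E7 (TangentSpace (𝓡 7) : M → Type _) p).linear ℝ hq).map_smul
          (f q) (σ q)
      rw [nabla.isCovariantDerivativeOnUniv.leibniz hσ hf, mvfderiv_congr e, mvfderiv_smul hf hc]
      simp only [add_apply, smul_apply, ContinuousLinearMap.smulRight_apply, map_add, map_smul]
      have e2 : (trivializationAt E7 (TangentSpace (𝓡 7) : M → Type _) p).symmL ℝ p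
          (coord p p (σ p)) = σ p := by
        rw [← hsymm]
        exact Trivialization.symm_apply_apply_mk _ hp _
      rw [e2]
      module
    · have e : (fun q => coord p q ((σ + σ') q)) =ᶠ[nhds p]
          (fun q => coord p q (σ q)) + fun q => coord p q (σ' q) := by
        filter_upwards [eventually_mem_baseSet p] with q hq
        exact ((trivializationAt E7 (TangentSpace (𝓡 7) : M → Type _) p).linear ℝ hq).map_add
          (σ q) (σ' q)
      rw [nabla.isCovariantDerivativeOnUniv.add hσ hσ', mvfderiv_congr e,
        mvfderiv_add (mdifferentiableAt_coord hσ) (mdifferentiableAt_coord hσ')]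
      simp only [add_apply, map_add]
      abel
  have h := htens.pointwise hY (FiberBundle.mdifferentiableAt_extend (𝓡 7) E7 (Y p))
    (by simp)
  rw [mvfderiv_coord_extend] at h
  simp only [zero_apply, map_zero, sub_zero] at h
  rw [hsymm, ← h]
  abel

section Surface

variable {S : Type*} [TopologicalSpace S] [ChartedSpace E2 S]

theorem alongDeriv_smul
    (nabla : CovariantDerivative (𝓡 7) E7 (TangentSpace (𝓡 7) : M → Type _))
    {ι : S → M} {V : ∀ y, TangentSpace (𝓡 7) (ι y)} {x : S}
    (hV : MDifferentiableAt (𝓡 2) ((𝓡 7).prod 𝓘(ℝ, E7)) (fun y => TotalSpace.mk' E7 (ι y) (V y)) x)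
    (r : ℝ) (v : TangentSpace (𝓡 2) x) :
    alongDeriv nabla ι (fun y => r • V y) x v = r • alongDeriv nabla ι V x v := by
  have hι : MDifferentiableAt (𝓡 2) (𝓡 7) ι x := ((mdifferentiableAt_totalSpace (𝓡 7) _).1 hV).1
  have hx := FiberBundle.mem_baseSet_trivializationAt' (F := E7)
    (E := (TangentSpace (𝓡 7) : M → Type _)) (ι x)
  have e : (fun y => coord (ι x) (ι y) (r • V y)) =ᶠ[nhds x]
      fun y => (r • ContinuousLinearMap.id ℝ E7) (coord (ι x) (ι y) (V y)) := by
    filter_upwards [hι.continuousAt.eventually (eventually_mem_baseSet (ι x))] with y hy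
    exact ((trivializationAt E7 (TangentSpace (𝓡 7) : M → Type _) (ι x)).linear ℝ hy).map_smul
      r (V y)
  have hext := FiberBundle.mdifferentiableAt_extend (𝓡 7) E7 (V x)
  have e2 : nabla (FiberBundle.extend E7 (r • V x)) (ι x)
      = nabla (r • FiberBundle.extend E7 (V x)) (ι x) := by
    refine nabla.isCovariantDerivativeOnUniv.congr_of_eventuallyEq
      (FiberBundle.mdifferentiableAt_extend (𝓡 7) E7 (r • V x)) (mdifferentiableAt_const.smul_section hext)
      Filter.univ_mem ?_
    filter_upwards [eventually_mem_baseSet (ι x)] with q hq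
    have h1 : coord (ι x) (ι x) (r • V x) = r • coord (ι x) (ι x) (V x) :=
      ((trivializationAt E7 (TangentSpace (𝓡 7) : M → Type _) (ι x)).linear ℝ hx).map_smul r (V x)
    have h2 := (isLinearMap_symm hq).map_smul r (coord (ι x) (ι x) (V x))
    rw [← h1] at h2
    exact h2
  rw [alongDeriv, alongDeriv, e2, nabla.isCovariantDerivativeOnUniv.smul_const r hext,
    mvfderiv_congr e, mvfderiv_clm_comp _ (mdifferentiableAt_coord hV), smul_add]
  congr 1
  exact (isLinearMap_symm hx).map_smul _ _

theorem contMDiffAt_mfderiv_extend [IsManifold (𝓡 2) ∞ S] {ι : S → M}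
    (hι : ContMDiff (𝓡 2) (𝓡 7) ∞ ι) {x : S} (w : TangentSpace (𝓡 2) x) :
    ContMDiffAt (𝓡 2) ((𝓡 7).prod 𝓘(ℝ, E7)) ∞ (fun y => (TotalSpace.mk' E7 (ι y)
      (mfderiv (𝓡 2) (𝓡 7) ι y (FiberBundle.extend E2 w y)) : TangentBundle (𝓡 7) M)) x :=
  ((hι.contMDiff_tangentMap (m := ∞) le_rfl) _).comp x
    (FiberBundle.contMDiffAt_extend (k := ∞) (𝓡 2) E2 w)

theorem contMDiffAt_smul_along {ι : S → M} {V : ∀ y, TangentSpace (𝓡 7) (ι y)} {r : S → ℝ} {x : S}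
    (hr : ContMDiffAt (𝓡 2) 𝓘(ℝ, ℝ) ∞ r x)
    (hV : ContMDiffAt (𝓡 2) ((𝓡 7).prod 𝓘(ℝ, E7)) ∞
      (fun y => (TotalSpace.mk' E7 (ι y) (V y) : TangentBundle (𝓡 7) M)) x) :
    ContMDiffAt (𝓡 2) ((𝓡 7).prod 𝓘(ℝ, E7)) ∞
      (fun y => (TotalSpace.mk' E7 (ι y) (r y • V y) : TangentBundle (𝓡 7) M)) x := by
  rw [contMDiffAt_totalSpace] at hV ⊢
  refine ⟨hV.1, (hr.smul hV.2).congr_of_eventuallyEq ?_⟩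
  filter_upwards [hV.1.continuousAt.eventually (eventually_mem_baseSet (ι x))] with y hy
  exact ((trivializationAt E7 (TangentSpace (𝓡 7) : M → Type _) (ι x)).linear ℝ hy).map_smul
    (r y) (V y)

end Surface

variable [RiemannianBundle (fun p : M => TangentSpace (𝓡 7) p)]

theorem mdifferentiableAt_cross (X : VectorCrossProduct M) {E H N : Type*} [NormedAddCommGroup E]
    [NormedSpace ℝ E] [TopologicalSpace H] {I : ModelWithCorners ℝ E H} [TopologicalSpace N]
    [ChartedSpace H N] {ι : N → M} {V W : ∀ y, TangentSpace (𝓡 7) (ι y)} {x : N}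
    (hV : MDifferentiableAt I ((𝓡 7).prod 𝓘(ℝ, E7)) (fun y => TotalSpace.mk' E7 (ι y) (V y)) x)
    (hW : MDifferentiableAt I ((𝓡 7).prod 𝓘(ℝ, E7)) (fun y => TotalSpace.mk' E7 (ι y) (W y)) x) :
    MDifferentiableAt I ((𝓡 7).prod 𝓘(ℝ, E7))
      (fun y => TotalSpace.mk' E7 (ι y) (X.cross (ι y) (V y) (W y))) x := by
  have hι : MDifferentiableAt I (𝓡 7) ι x := ((mdifferentiableAt_totalSpace (𝓡 7) _).1 hV).1
  exact MDifferentiableAt.clm_bundle_apply₂ (F₁ := E7) (F₂ := E7) (F₃ := E7)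
    (((X.smooth (ι x)).mdifferentiableAt (by simp)).comp x hι) hV hW

/-- The cross product in the coordinates of the preferred trivialization at `p`. -/
noncomputable def crossCoord (X : VectorCrossProduct M) (p q : M) : E7 →L[ℝ] E7 →L[ℝ] E7 :=
  ContinuousLinearMap.inCoordinates E7 (TangentSpace (𝓡 7) : M → Type _) (E7 →L[ℝ] E7)
    (fun q : M => TangentSpace (𝓡 7) q →L[ℝ] TangentSpace (𝓡 7) q) p q p q (X.cross q)

theorem mdifferentiableAt_crossCoord (X : VectorCrossProduct M) (p : M) :
    MDifferentiableAt (𝓡 7) 𝓘(ℝ, E7 →L[ℝ] E7 →L[ℝ] E7) (crossCoord X p) p :=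
  ((mdifferentiableAt_hom_bundle _).1 ((X.smooth p).mdifferentiableAt (by simp))).2

theorem coord_cross (X : VectorCrossProduct M) {p q : M}
    (hq : q ∈ (trivializationAt E7 (TangentSpace (𝓡 7) : M → Type _) p).baseSet)
    (a b : TangentSpace (𝓡 7) q) :
    coord p q (X.cross q a b) = crossCoord X p q (coord p q a) (coord p q b) := by
  have ha : (trivializationAt E7 (TangentSpace (𝓡 7) : M → Type _) p).symm q (coord p q a) = a :=
    Trivialization.symm_apply_apply_mk _ hq _
  have hb : (trivializationAt E7 (TangentSpace (𝓡 7) : M → Type _) p).symm q (coord p q b) = b :=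
    Trivialization.symm_apply_apply_mk _ hq _
  have h := inCoordinates_apply_eq₂ (𝕜 := ℝ) (F₁ := E7) (F₂ := E7) (F₃ := E7)
    (E₁ := (TangentSpace (𝓡 7) : M → Type _)) (E₂ := (TangentSpace (𝓡 7) : M → Type _))
    (E₃ := (TangentSpace (𝓡 7) : M → Type _)) (x₀ := p) (ϕ := X.cross q)
    (v := coord p q a) (w := coord p q b) hq hq hq
  rw [ha, hb, Trivialization.coe_linearMapAt_of_mem _ hq] at h
  exact h.symm

/-- Coordinate form of the product rule along a map `ι`. -/
theorem mvfderiv_coord_cross (X : VectorCrossProduct M) {E H N : Type*} [NormedAddCommGroup E]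
    [NormedSpace ℝ E] [TopologicalSpace H] {I : ModelWithCorners ℝ E H} [TopologicalSpace N]
    [ChartedSpace H N] {ι : N → M} {V W : ∀ y, TangentSpace (𝓡 7) (ι y)} {x : N}
    (hV : MDifferentiableAt I ((𝓡 7).prod 𝓘(ℝ, E7)) (fun y => TotalSpace.mk' E7 (ι y) (V y)) x)
    (hW : MDifferentiableAt I ((𝓡 7).prod 𝓘(ℝ, E7)) (fun y => TotalSpace.mk' E7 (ι y) (W y)) x)
    (v : TangentSpace I x) :
    mvfderiv I (fun y => coord (ι x) (ι y) (X.cross (ι y) (V y) (W y))) x v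
      = mvfderiv (𝓡 7) (crossCoord X (ι x)) (ι x) (mfderiv I (𝓡 7) ι x v)
          (coord (ι x) (ι x) (V x)) (coord (ι x) (ι x) (W x))
        + crossCoord X (ι x) (ι x) (mvfderiv I (fun y => coord (ι x) (ι y) (V y)) x v)
          (coord (ι x) (ι x) (W x))
        + crossCoord X (ι x) (ι x) (coord (ι x) (ι x) (V x))
          (mvfderiv I (fun y => coord (ι x) (ι y) (W y)) x v) := by
  have hι : MDifferentiableAt I (𝓡 7) ι x := ((mdifferentiableAt_totalSpace (𝓡 7) _).1 hV).1
  have hB := mdifferentiableAt_crossCoord X (ι x)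
  have hBι : MDifferentiableAt I 𝓘(ℝ, E7 →L[ℝ] E7 →L[ℝ] E7) (fun y => crossCoord X (ι x) (ι y)) x :=
    hB.comp x hι
  have hV' := mdifferentiableAt_coord hV
  have hW' := mdifferentiableAt_coord hW
  have e : (fun y => coord (ι x) (ι y) (X.cross (ι y) (V y) (W y))) =ᶠ[nhds x] fun y =>
      crossCoord X (ι x) (ι y) (coord (ι x) (ι y) (V y)) (coord (ι x) (ι y) (W y)) := by
    filter_upwards [hι.continuousAt.eventually (eventually_mem_baseSet (ι x))] with y hy
    exact coord_cross X hy _ _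
  rw [mvfderiv_congr e, mvfderiv_clm_apply (hBι.clm_apply hV') hW', mvfderiv_clm_apply hBι hV',
    mvfderiv_comp_vector hB hι]
  rfl

theorem symm_crossCoord (X : VectorCrossProduct M) (p : M) (a b : E7) :
    (trivializationAt E7 (TangentSpace (𝓡 7) : M → Type _) p).symm p (crossCoord X p p a b)
      = X.cross p ((trivializationAt E7 (TangentSpace (𝓡 7) : M → Type _) p).symm p a)
          ((trivializationAt E7 (TangentSpace (𝓡 7) : M → Type _) p).symm p b) := by
  have hp := FiberBundle.mem_baseSet_trivializationAt' (F := E7)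
    (E := (TangentSpace (𝓡 7) : M → Type _)) p
  have h : ∀ a, coord p p ((trivializationAt E7 (TangentSpace (𝓡 7) : M → Type _) p).symm p a) = a :=
    fun a => congrArg Prod.snd (Trivialization.apply_mk_symm
      (trivializationAt E7 (TangentSpace (𝓡 7) : M → Type _) p) hp a)
  have h1 := coord_cross X hp
    ((trivializationAt E7 (TangentSpace (𝓡 7) : M → Type _) p).symm p a)
    ((trivializationAt E7 (TangentSpace (𝓡 7) : M → Type _) p).symm p b)
  rw [h, h] at h1
  rw [← h1, symm_coord]

variable [IsContMDiffRiemannianBundle (𝓡 7) ∞ E7 (fun p : M => TangentSpace (𝓡 7) p)]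

/-- `∇Ω = 0` and `∇g = 0` give `∇(Y × Z) = ∇Y × Z + Y × ∇Z` for vector fields on `M`. -/
theorem nabla_cross {nabla : CovariantDerivative (𝓡 7) E7 (TangentSpace (𝓡 7) : M → Type _)}
    (hnabla : IsLeviCivita nabla) {X : VectorCrossProduct M} (hX : X.IsParallel nabla)
    {Y Z : ∀ q : M, TangentSpace (𝓡 7) q} {p : M}
    (hY : MDifferentiableAt (𝓡 7) ((𝓡 7).prod 𝓘(ℝ, E7)) (fun q => TotalSpace.mk' E7 q (Y q)) p)
    (hZ : MDifferentiableAt (𝓡 7) ((𝓡 7).prod 𝓘(ℝ, E7)) (fun q => TotalSpace.mk' E7 q (Z q)) p)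
    (u : TangentSpace (𝓡 7) p) :
    nabla (fun q => X.cross q (Y q) (Z q)) p u
      = X.cross p (nabla Y p u) (Z p) + X.cross p (Y p) (nabla Z p u) := by
  have : IsContMDiffRiemannianBundle (𝓡 7) 1 E7 (fun p : M => TangentSpace (𝓡 7) p) :=
    IsContMDiffRiemannianBundle.of_le (n := ∞) (by norm_cast)
  refine ext_inner_right ℝ fun w => ?_
  have hW := FiberBundle.mdifferentiableAt_extend (𝓡 7) E7 w
  have h1 := hX Y Z (FiberBundle.extend E7 w) p hY hZ hW u
  have h2 := hnabla.1.mvfderiv_inner_eq (FiberBundle.extend E7 u) (mdifferentiableAt_cross X hY hZ)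
    hW
  simp only [FiberBundle.extend_apply_self] at h1 h2
  simp only [VectorCrossProduct.Omega] at h1
  rw [h2] at h1
  rw [inner_add_left]
  linarith

variable {S : Type*} [TopologicalSpace S] [ChartedSpace E2 S]

/-- The cross product is parallel for the pulled-back connection on `ι^* TM`. The derivative of the
coordinates of the cross product is read off from `nabla_cross` for constant coordinates. -/
theorem alongDeriv_cross
    {nabla : CovariantDerivative (𝓡 7) E7 (TangentSpace (𝓡 7) : M → Type _)}
    (hnabla : IsLeviCivita nabla) {X : VectorCrossProduct M} (hX : X.IsParallel nabla)
    {ι : S → M} {V W : ∀ y, TangentSpace (𝓡 7) (ι y)} {x : S}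
    (hV : MDifferentiableAt (𝓡 2) ((𝓡 7).prod 𝓘(ℝ, E7)) (fun y => TotalSpace.mk' E7 (ι y) (V y)) x)
    (hW : MDifferentiableAt (𝓡 2) ((𝓡 7).prod 𝓘(ℝ, E7)) (fun y => TotalSpace.mk' E7 (ι y) (W y)) x)
    (v : TangentSpace (𝓡 2) x) :
    alongDeriv nabla ι (fun y => X.cross (ι y) (V y) (W y)) x v
      = X.cross (ι x) (alongDeriv nabla ι V x v) (W x)
        + X.cross (ι x) (V x) (alongDeriv nabla ι W x v) := by
  set u := mfderiv (𝓡 2) (𝓡 7) ι x v with hu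
  have hY := FiberBundle.mdifferentiableAt_extend (𝓡 7) E7 (V x)
  have hZ := FiberBundle.mdifferentiableAt_extend (𝓡 7) E7 (W x)
  have hid : mfderiv (𝓡 7) (𝓡 7) (fun q : M => q) (ι x) u = u :=
    congrArg (fun L : E7 →L[ℝ] E7 => L u) (mfderiv_id (I := 𝓡 7) (x := ι x))
  have hsymm := isLinearMap_symm (FiberBundle.mem_baseSet_trivializationAt' (F := E7)
    (E := (TangentSpace (𝓡 7) : M → Type _)) (ι x))
  have h1 := nabla_cross hnabla hX hY hZ u
  rw [nabla_eq nabla (mdifferentiableAt_cross (ι := fun q => q) X hY hZ),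
    mvfderiv_coord_cross X (ι := fun q : M => q) hY hZ u] at h1
  simp only [FiberBundle.extend_apply_self, mvfderiv_coord_extend, zero_apply, map_zero, hid,
    add_zero] at h1
  rw [← eq_sub_iff_add_eq] at h1
  change (trivializationAt E7 (TangentSpace (𝓡 7) : M → Type _) (ι x)).symm (ι x)
    (mvfderiv (𝓡 2) (fun y => coord (ι x) (ι y) (X.cross (ι y) (V y) (W y))) x v) + _ = _
  rw [mvfderiv_coord_cross X hV hW v, hsymm.map_add, hsymm.map_add, h1, symm_crossCoord,
    symm_crossCoord, symm_coord, symm_coord]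
  simp only [alongDeriv, map_add, add_apply]
  abel

end Connection

/-! ### Tangent spaces of a surface in `M` -/

section Tangent

variable {M : Type*} [TopologicalSpace M] [ChartedSpace E7 M]
  {S : Type*} [TopologicalSpace S] [ChartedSpace E2 S] {ι : S → M} {x : S}

theorem mem_tangentOf (t : TangentSpace (𝓡 7) (ι x)) :
    t ∈ tangentOf (𝓡 2) ι x ↔ ∃ v, mfderiv (𝓡 2) (𝓡 7) ι x v = t := Iff.rfl

theorem finrank_tangentOf
    (hι : Function.Injective (mfderiv (𝓡 2) (𝓡 7) ι x)) :
    Module.finrank ℝ (tangentOf (𝓡 2) ι x) = 2 := by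
  have h := LinearMap.finrank_range_of_inj (f := (mfderiv (𝓡 2) (𝓡 7) ι x).toLinearMap) hι
  exact h.trans (finrank_euclideanSpace_fin (𝕜 := ℝ) (n := 2))

theorem mfderiv_leftInverse
    (hι : Function.Injective (mfderiv (𝓡 2) (𝓡 7) ι x)) {t : TangentSpace (𝓡 7) (ι x)}
    (ht : t ∈ tangentOf (𝓡 2) ι x) :
    mfderiv (𝓡 2) (𝓡 7) ι x ((mfderiv (𝓡 2) (𝓡 7) ι x).toLinearMap.leftInverse t) = t := by
  obtain ⟨v, rfl⟩ := ht
  exact congrArg _ (LinearMap.leftInverse_apply_of_inj (LinearMap.ker_eq_bot.2 hι) v)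

variable [RiemannianBundle (fun p : M => TangentSpace (𝓡 7) p)]

theorem mfderiv_frame
    (hι : Function.Injective (mfderiv (𝓡 2) (𝓡 7) ι x)) (i) :
    mfderiv (𝓡 2) (𝓡 7) ι x (frame ι x i) = stdOrthonormalBasis ℝ (tangentOf (𝓡 2) ι x) i :=
  mfderiv_leftInverse hι (Subtype.mem _)

theorem norm_mfderiv_frame
    (hι : Function.Injective (mfderiv (𝓡 2) (𝓡 7) ι x)) (i) :
    ‖mfderiv (𝓡 2) (𝓡 7) ι x (frame ι x i)‖ = 1 := by
  rw [mfderiv_frame hι]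
  exact (stdOrthonormalBasis ℝ (tangentOf (𝓡 2) ι x)).orthonormal.1 i

theorem mfderiv_tangentDeriv [IsManifold (𝓡 7) ∞ M] [IsManifold (𝓡 2) ∞ S]
    (nabla : CovariantDerivative (𝓡 7) E7 (TangentSpace (𝓡 7) : M → Type _))
    (W : ∀ y : S, TangentSpace (𝓡 2) y)
    (hι : Function.Injective (mfderiv (𝓡 2) (𝓡 7) ι x)) (v : TangentSpace (𝓡 2) x) :
    mfderiv (𝓡 2) (𝓡 7) ι x (tangentDeriv nabla ι W x v)
      = inducedDeriv nabla ι (fun y => tangentOf (𝓡 2) ι y)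
          (fun y => mfderiv (𝓡 2) (𝓡 7) ι y (W y)) x v :=
  mfderiv_leftInverse hι (Submodule.starProjection_apply_mem _ _)

end Tangent

/-! ### Holomorphic curves in coassociative submanifolds -/

section Curve

variable {M : Type*} [TopologicalSpace M] [ChartedSpace E7 M] [IsManifold (𝓡 7) ∞ M]
  [RiemannianBundle (fun p : M => TangentSpace (𝓡 7) p)]
  {C : Type*} [TopologicalSpace C] [ChartedSpace E4 C]
  {S : Type*} [TopologicalSpace S] [ChartedSpace E2 S]

theorem VectorCrossProduct.isCross (X : VectorCrossProduct M) (p : M) : IsCross (X.cross p) :=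
  ⟨X.skew p, X.perp_right p, X.norm_sq p⟩

variable {X : VectorCrossProduct M} {ε : ℝ} {φ : ℝ → C → M}
  {n : ∀ z : C, TangentSpace (𝓡 7) (φ 0 z)} (hφ : IsCoassociativeFamily X ε φ n)
  {j : S → C} (hj : IsHolomorphicCurve X φ n j)

include hφ hj

theorem mfderiv_curve (x : S) (v : TangentSpace (𝓡 2) x) :
    mfderiv (𝓡 2) (𝓡 7) (curve φ j) x v
      = mfderiv (𝓡 4) (𝓡 7) (φ 0) (j x) (mfderiv (𝓡 2) (𝓡 4) j x v) :=
  mfderiv_comp_apply x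
    (((hφ.embeds 0 ⟨le_rfl, hφ.pos.le⟩).smooth (j x)).mdifferentiableAt (by simp))
    ((hj.embeds.smooth x).mdifferentiableAt (by simp)) v

theorem contMDiff_curve : ContMDiff (𝓡 2) (𝓡 7) ∞ (curve φ j) :=
  (hφ.embeds 0 ⟨le_rfl, hφ.pos.le⟩).smooth.comp hj.embeds.smooth

theorem mfderiv_curve_injective (x : S) :
    Function.Injective (mfderiv (𝓡 2) (𝓡 7) (curve φ j) x) := fun v w hvw => by
  rw [mfderiv_curve hφ hj, mfderiv_curve hφ hj] at hvw
  exact hj.embeds.injective x ((hφ.embeds 0 ⟨le_rfl, hφ.pos.le⟩).injective _ hvw)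

/-- The tangent spaces of the curve and of the coassociative submanifold form a flag as in
`HolomorphicFlag`. -/
theorem holomorphicFlag (hn : ∀ z, n z ≠ 0) (x : S) :
    HolomorphicFlag (X.cross (curve φ j x)) (n (j x)) (tangentOf (𝓡 4) (φ 0) (j x))
      (tangentOf (𝓡 2) (curve φ j) x) where
  isCross := X.isCross _
  finrank_ambient := finrank_euclideanSpace_fin (𝕜 := ℝ) (n := 7)
  finrank_four := by
    have h := LinearMap.finrank_range_of_inj
      (f := (mfderiv (𝓡 4) (𝓡 7) (φ 0) (j x)).toLinearMap)
      ((hφ.embeds 0 ⟨le_rfl, hφ.pos.le⟩).injective (j x))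
    exact h.trans (finrank_euclideanSpace_fin (𝕜 := ℝ) (n := 4))
  finrank_two := finrank_tangentOf (mfderiv_curve_injective hφ hj x)
  coassociative := by
    rintro _ ⟨u, rfl⟩ _ ⟨v, rfl⟩ _ ⟨w, rfl⟩
    exact hφ.coassociative 0 ⟨le_rfl, hφ.pos.le⟩ (j x) u v w
  ne_zero := hn (j x)
  normal := hφ.normal (j x)
  le := by
    rintro _ ⟨v, rfl⟩
    exact ⟨_, (mfderiv_curve hφ hj x v).symm⟩
  holomorphic := hj.holomorphic x

variable (hn : ∀ z, n z ≠ 0)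
  [IsContMDiffRiemannianBundle (𝓡 7) ∞ E7 (fun p : M => TangentSpace (𝓡 7) p)]
  [IsManifold (𝓡 2) ∞ S]

include hn

/-! ### The map `f` and the two Dirac operators -/

/-- `f` maps smooth sections to smooth sections: near a given point, `f(β)` is
`-√2 |e|⁻² β(e) × e` for any smooth nonvanishing tangent field `e`. -/
theorem isSection_fMap {β : ∀ x, TangentSpace (𝓡 2) x →L[ℝ] TangentSpace (𝓡 7) (curve φ j x)}
    (hβ : IsForm01Section (curve φ j) (curveJ X φ n j) (normalInC φ j) β) :
    IsSection (curve φ j) (normalOfSweep φ n j) (fun x => fMap X (curve φ j) x (β x)) := by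
  have hinj := mfderiv_curve_injective hφ hj
  have hcard : ∀ x, Fintype.card (Fin (Module.finrank ℝ (tangentOf (𝓡 2) (curve φ j) x))) = 2 :=
    fun x => by rw [Fintype.card_fin, finrank_tangentOf (hinj x)]
  refine ⟨fun x => (holomorphicFlag hφ hj hn x).traceMap_mem mem_tangentOf (hβ.1 x), fun x => ?_⟩
  obtain ⟨i⟩ : Nonempty (Fin (Module.finrank ℝ (tangentOf (𝓡 2) (curve φ j) x))) :=
    Fintype.card_pos_iff.1 (by rw [hcard]; norm_num)
  set w := frame (curve φ j) x i
  have hw : ‖mfderiv (𝓡 2) (𝓡 7) (curve φ j) x w‖ = 1 := norm_mfderiv_frame (hinj x) i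
  have he := contMDiffAt_mfderiv_extend (contMDiff_curve hφ hj) w
  have hnorm := he.inner_bundle he
  have hne : inner ℝ (mfderiv (𝓡 2) (𝓡 7) (curve φ j) x (FiberBundle.extend E2 w x))
      (mfderiv (𝓡 2) (𝓡 7) (curve φ j) x (FiberBundle.extend E2 w x)) ≠ 0 := by
    rw [FiberBundle.extend_apply_self, real_inner_self_eq_norm_sq, hw]
    norm_num
  have hcross : ContMDiffAt (𝓡 2) ((𝓡 7).prod 𝓘(ℝ, E7)) ∞
      (fun y => (TotalSpace.mk' E7 (curve φ j y) (X.cross (curve φ j y)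
        (β y (FiberBundle.extend E2 w y))
        (mfderiv (𝓡 2) (𝓡 7) (curve φ j) y (FiberBundle.extend E2 w y))) :
          TangentBundle (𝓡 7) M)) x :=
    ContMDiffAt.clm_bundle_apply₂ (F₁ := E7) (F₂ := E7) (F₃ := E7)
      ((X.smooth _).comp x (contMDiff_curve hφ hj x)) (hβ.2 x w) he
  refine (contMDiffAt_smul_along (r := fun y => -(√2 *
    (inner ℝ (mfderiv (𝓡 2) (𝓡 7) (curve φ j) y (FiberBundle.extend E2 w y))
      (mfderiv (𝓡 2) (𝓡 7) (curve φ j) y (FiberBundle.extend E2 w y)))⁻¹))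
    (contMDiffAt_const.mul (hnorm.inv₀ hne)).neg hcross).congr_of_eventuallyEq ?_
  filter_upwards [hnorm.continuousAt.eventually_ne hne] with y hy
  have hy' : mfderiv (𝓡 2) (𝓡 7) (curve φ j) y (FiberBundle.extend E2 w y) ≠ 0 := fun h0 =>
    hy (by rw [h0, inner_zero_left])
  have h := (holomorphicFlag hφ hj hn y).traceMap_eq (hinj y) mem_tangentOf (hcard y)
    (norm_mfderiv_frame (hinj y)) (hβ.1 y) hy'
  rw [real_inner_self_eq_norm_sq, neg_smul]
  exact congrArg _ h

/-- `f` is parallel up to Clifford multiplication: the derivative of `e × f(β) = -√2 β(e)` along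
the curve, projected to `N_{Σ/C}`. -/
theorem cross_inducedDeriv_fMap
    {nabla : CovariantDerivative (𝓡 7) E7 (TangentSpace (𝓡 7) : M → Type _)}
    (hnabla : IsLeviCivita nabla) (hX : X.IsParallel nabla)
    {β : ∀ x, TangentSpace (𝓡 2) x →L[ℝ] TangentSpace (𝓡 7) (curve φ j x)}
    (hβ : IsForm01Section (curve φ j) (curveJ X φ n j) (normalInC φ j) β) (x : S)
    (v w : TangentSpace (𝓡 2) x) :
    X.cross (curve φ j x) (mfderiv (𝓡 2) (𝓡 7) (curve φ j) x w)
        (inducedDeriv nabla (curve φ j) (normalOfSweep φ n j)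
          (fun y => fMap X (curve φ j) y (β y)) x v)
      = -(√2 • formDeriv nabla (curve φ j) (normalInC φ j) β x v w) := by
  have hinj := mfderiv_curve_injective hφ hj
  have hcard : ∀ x, Fintype.card (Fin (Module.finrank ℝ (tangentOf (𝓡 2) (curve φ j) x))) = 2 :=
    fun x => by rw [Fintype.card_fin, finrank_tangentOf (hinj x)]
  have hflag := holomorphicFlag hφ hj hn x
  have hsec := isSection_fMap hφ hj hn hβ
  have he := (contMDiffAt_mfderiv_extend (contMDiff_curve hφ hj) w).mdifferentiableAt (by simp)
  have hcl : ∀ y (w : TangentSpace (𝓡 2) y), X.cross (curve φ j y)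
      (mfderiv (𝓡 2) (𝓡 7) (curve φ j) y w) (fMap X (curve φ j) y (β y)) = (-√2) • β y w :=
    fun y w => ((holomorphicFlag hφ hj hn y).cross_traceMap (hinj y) mem_tangentOf (hcard y)
      (norm_mfderiv_frame (hinj y)) (hβ.1 y) w).trans (neg_smul _ _).symm
  have h := alongDeriv_cross hnabla hX he ((hsec.2 x).mdifferentiableAt (by simp)) v
  rw [funext fun y => hcl y _,
    alongDeriv_smul nabla ((hβ.2 x w).mdifferentiableAt (by simp))] at h
  have h2 := congrArg (normalInC φ j x).starProjection h
  rw [map_add, map_smul] at h2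
  have h3 := hflag.projection_cross_left (alongDeriv nabla (curve φ j)
    (fun y => mfderiv (𝓡 2) (𝓡 7) (curve φ j) y (FiberBundle.extend E2 w y)) x v) (hsec.1 x)
  have h4 := hflag.projection_cross_right (alongDeriv nabla (curve φ j)
    (fun y => fMap X (curve φ j) y (β y)) x v)
    (e := mfderiv (𝓡 2) (𝓡 7) (curve φ j) x (FiberBundle.extend E2 w x)) ⟨_, rfl⟩
  have h5 := mfderiv_tangentDeriv nabla (FiberBundle.extend E2 w) (hinj x) v
  have h6 := hcl x (tangentDeriv nabla (curve φ j) (FiberBundle.extend E2 w) x v)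
  rw [h5] at h6
  have h7 := h2.trans (congrArg₂ (· + ·) (h3.trans h6) h4)
  rw [FiberBundle.extend_apply_self] at h7
  rw [formDeriv, smul_sub, neg_sub]
  refine (sub_eq_iff_eq_add'.2 h7).symm.trans ?_
  rw [neg_smul, neg_smul, sub_neg_eq_add, add_comm, ← sub_eq_add_neg]
  rfl

/-- `Φ ∘ (Dolbeault Dirac operator) = (G₂ Dirac operator) ∘ Φ`, term by term for a frame:
`cross_inducedDeriv_fMap` matches the derivatives of the form part, `traceMap_form` those of the
`N_{Σ/C}`-part. -/
theorem phiMap_dolbeaultDirac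
    {nabla : CovariantDerivative (𝓡 7) E7 (TangentSpace (𝓡 7) : M → Type _)}
    (hnabla : IsLeviCivita nabla) (hX : X.IsParallel nabla)
    {u : ∀ x, TangentSpace (𝓡 7) (curve φ j x)}
    {β : ∀ x, TangentSpace (𝓡 2) x →L[ℝ] TangentSpace (𝓡 7) (curve φ j x)}
    (hu : IsSection (curve φ j) (normalInC φ j) u)
    (hβ : IsForm01Section (curve φ j) (curveJ X φ n j) (normalInC φ j) β) (x : S) :
    phiMap X (curve φ j) x
        (dolbeaultDirac nabla (curve φ j) (curveJ X φ n j) (normalInC φ j)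
          (fun y => (u y, β y)) x)
      = g2Dirac X nabla (curve φ j) (normalInC φ j) (normalOfSweep φ n j)
          (fun y => phiMap X (curve φ j) y (u y, β y)) x := by
  have hsec := isSection_fMap hφ hj hn hβ
  have hinj := mfderiv_curve_injective hφ hj
  have hflag := holomorphicFlag hφ hj hn x
  have hle : ∀ y, normalInC φ j y ≤ (normalOfSweep φ n j y)ᗮ := fun y =>
    (inf_le_left.trans le_sup_left).trans (Submodule.le_orthogonal_orthogonal _)
  have hp1 : (fun y => (normalInC φ j y).starProjection (phiMap X (curve φ j) y (u y, β y))) = u := by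
    funext y
    rw [phiMap, map_add, Submodule.starProjection_eq_self_iff.2 (hu.1 y),
      (Submodule.starProjection_apply_eq_zero_iff _).2
        (Submodule.orthogonal_le (hle y) (Submodule.le_orthogonal_orthogonal _ (hsec.1 y))),
      add_zero]
  have hp2 : (fun y => (normalOfSweep φ n j y).starProjection
      (phiMap X (curve φ j) y (u y, β y))) = fun y => fMap X (curve φ j) y (β y) := by
    funext y
    rw [phiMap, map_add, Submodule.starProjection_eq_self_iff.2 (hsec.1 y),
      (Submodule.starProjection_apply_eq_zero_iff _).2 (hle y (hu.1 y)), zero_add]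
  have hup : ∀ i, fMap X (curve φ j) x (cliffordUp (curve φ j) (curveJ X φ n j) x
        (frame (curve φ j) x i) (inducedDeriv nabla (curve φ j) (normalInC φ j) u x
          (frame (curve φ j) x i)))
      = X.cross (curve φ j x) (mfderiv (𝓡 2) (𝓡 7) (curve φ j) x (frame (curve φ j) x i))
          (inducedDeriv nabla (curve φ j) (normalInC φ j) u x (frame (curve φ j) x i)) := fun i => by
    have hmem : inducedDeriv nabla (curve φ j) (normalInC φ j) u x (frame (curve φ j) x i)
        ∈ normalInC φ j x := Submodule.starProjection_apply_mem _ _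
    refine (hflag.traceMap_form (hinj x) mem_tangentOf
      ((Fintype.card_fin _).trans (finrank_tangentOf (hinj x))) (norm_mfderiv_frame (hinj x))
      (norm_mfderiv_frame (hinj x) i) (r := √2 * 2⁻¹) hmem
      fun w => ?_).trans ?_
    · rw [mul_smul]; rfl
    · rw [← mul_assoc, Real.mul_self_sqrt (by norm_num), mul_inv_cancel₀ (by norm_num), one_smul]
  have hsum : fMap X (curve φ j) x
      (dolbeaultUp nabla (curve φ j) (curveJ X φ n j) (normalInC φ j) u x)
      = ∑ i, fMap X (curve φ j) x (cliffordUp (curve φ j) (curveJ X φ n j) x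
        (frame (curve φ j) x i) (inducedDeriv nabla (curve φ j) (normalInC φ j) u x
          (frame (curve φ j) x i))) := traceMap_sum _ _ _ _
  rw [g2Dirac]
  simp only [sumDeriv, hp1, hp2, map_add, cross_inducedDeriv_fMap hφ hj hn hnabla hX hβ,
    Finset.sum_add_distrib]
  rw [phiMap, dolbeaultDirac, hsum, Finset.sum_congr rfl fun i _ => hup i, add_comm]
  rfl

end Curve

end G2Dirac

open G2Dirac in
theorem proposition4
    {M : Type*} [TopologicalSpace M] [ChartedSpace E7 M] [IsManifold (𝓡 7) ∞ M]
    [RiemannianBundle (fun p : M => TangentSpace (𝓡 7) p)]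
    [IsContMDiffRiemannianBundle (𝓡 7) ∞ E7 (fun p : M => TangentSpace (𝓡 7) p)]
    {C : Type*} [TopologicalSpace C] [ChartedSpace E4 C] [IsManifold (𝓡 4) ∞ C]
    {S : Type*} [TopologicalSpace S] [ChartedSpace E2 S] [IsManifold (𝓡 2) ∞ S]
    (nabla : CovariantDerivative (𝓡 7) E7 (TangentSpace (𝓡 7) : M → Type _))
    (hnabla : IsLeviCivita nabla)
    (X : VectorCrossProduct M) (hX : X.IsParallel nabla)
    (ε : ℝ) (φ : ℝ → C → M) (n : ∀ z : C, TangentSpace (𝓡 7) (φ 0 z))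
    (hφ : IsCoassociativeFamily X ε φ n) (hn : ∀ z, n z ≠ 0)
    (j : S → C) (hj : IsHolomorphicCurve X φ n j) :
    -- `f` is a conjugate linear isomorphism of `Λ^{0,1}(N_{Σ/C})` onto `N_{𝒞/M}|_Σ`
    (∀ x, Set.BijOn (fMap X (curve φ j) x)
        (Form01 (curve φ j) (curveJ X φ n j) (normalInC φ j) x) (normalOfSweep φ n j x)) ∧
    (∀ x, ∀ b ∈ Form01 (curve φ j) (curveJ X φ n j) (normalInC φ j) x,
        fMap X (curve φ j) x ((curveJ X φ n j x).comp b)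
          = - curveJ X φ n j x (fMap X (curve φ j) x b)) ∧
    (∀ β, IsForm01Section (curve φ j) (curveJ X φ n j) (normalInC φ j) β →
        IsSection (curve φ j) (normalOfSweep φ n j) (fun x => fMap X (curve φ j) x (β x))) ∧
    -- `f(s ⊗ Z̄^*) = -(1/√2) s × Z`
    (∀ (x : S) (v w : TangentSpace (𝓡 2) x), ∀ s ∈ normalInC φ j x,
        ‖mfderiv (𝓡 2) (𝓡 7) (curve φ j) x v‖ = 1 →
        mfderiv (𝓡 2) (𝓡 7) (curve φ j) x w
          = curveJ X φ n j x (mfderiv (𝓡 2) (𝓡 7) (curve φ j) x v) →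
        tensorZbar (curve φ j) (curveJ X φ n j) x v w s
            ∈ Form01 (curve φ j) (curveJ X φ n j) (normalInC φ j) x ∧
        fMap X (curve φ j) x (tensorZbar (curve φ j) (curveJ X φ n j) x v w s)
          = -((√2)⁻¹ • (√2)⁻¹ •
              (X.cross (curve φ j x) s (mfderiv (𝓡 2) (𝓡 7) (curve φ j) x v)
                - X.cross (curve φ j x) (curveJ X φ n j x s)
                    (mfderiv (𝓡 2) (𝓡 7) (curve φ j) x w)))) ∧
    -- `Φ ∘ (Dolbeault Dirac operator) = (G₂ Dirac operator) ∘ Φ` with `Φ = id ⊕ f`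
    (∀ (u : ∀ x, TangentSpace (𝓡 7) (curve φ j x))
        (β : ∀ x, TangentSpace (𝓡 2) x →L[ℝ] TangentSpace (𝓡 7) (curve φ j x)),
        IsSection (curve φ j) (normalInC φ j) u →
        IsForm01Section (curve φ j) (curveJ X φ n j) (normalInC φ j) β →
        ∀ x, phiMap X (curve φ j) x
            (dolbeaultDirac nabla (curve φ j) (curveJ X φ n j) (normalInC φ j)
              (fun y => (u y, β y)) x)
          = g2Dirac X nabla (curve φ j) (normalInC φ j) (normalOfSweep φ n j)
              (fun y => phiMap X (curve φ j) y (u y, β y)) x) := by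
  have hinj := mfderiv_curve_injective hφ hj
  have hcard : ∀ x, Fintype.card (Fin (Module.finrank ℝ (tangentOf (𝓡 2) (curve φ j) x))) = 2 :=
    fun x => (Fintype.card_fin _).trans (finrank_tangentOf (hinj x))
  refine ⟨fun x => ?_, fun x b hb => ?_, fun β hβ => isSection_fMap hφ hj hn hβ,
    fun x v w s hs hv hw => ?_,
    fun u β hu hβ x => phiMap_dolbeaultDirac hφ hj hn hnabla hX hu hβ x⟩
  · exact (holomorphicFlag hφ hj hn x).traceMap_bijOn (hinj x) mem_tangentOf (hcard x)
      (norm_mfderiv_frame (hinj x))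
  · exact (holomorphicFlag hφ hj hn x).traceMap_rotation_comp mem_tangentOf hb
  · have hflag := holomorphicFlag hφ hj hn x
    -- For `w = J v` one has `⟨w, ·⟩ = -⟨v, J ·⟩`, so that `s ⊗ Z̄^*` is a multiple of `(v^♭)^{0,1} ⊗ s`.
    have hform : ∀ w', tensorZbar (curve φ j) (curveJ X φ n j) x v w s w'
        = (√2)⁻¹ • (inner ℝ (mfderiv (𝓡 2) (𝓡 7) (curve φ j) x v)
            (mfderiv (𝓡 2) (𝓡 7) (curve φ j) x w') • s
          + inner ℝ (mfderiv (𝓡 2) (𝓡 7) (curve φ j) x v)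
            (rotation (X.cross (curve φ j x)) (n (j x)) (mfderiv (𝓡 2) (𝓡 7) (curve φ j) x w'))
              • rotation (X.cross (curve φ j x)) (n (j x)) s) := fun w' => by
      have h1 : inner ℝ (mfderiv (𝓡 2) (𝓡 7) (curve φ j) x v)
          (rotation (X.cross (curve φ j x)) (n (j x)) (mfderiv (𝓡 2) (𝓡 7) (curve φ j) x w'))
          = -inner ℝ (mfderiv (𝓡 2) (𝓡 7) (curve φ j) x w)
            (mfderiv (𝓡 2) (𝓡 7) (curve φ j) x w') := by
        rw [real_inner_comm, hflag.inner_rotation, hw]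
        rfl
      rw [h1, neg_smul, ← sub_eq_add_neg]
      rfl
    refine ⟨hflag.mem_formFibre mem_tangentOf hs hform, ?_⟩
    refine (hflag.traceMap_form (hinj x) mem_tangentOf (hcard x) (norm_mfderiv_frame (hinj x))
      hv hs hform).trans ?_
    have h2 : X.cross (curve φ j x) (curveJ X φ n j x s) (mfderiv (𝓡 2) (𝓡 7) (curve φ j) x w)
        = -X.cross (curve φ j x) s (mfderiv (𝓡 2) (𝓡 7) (curve φ j) x v) := by
      rw [hw]
      exact hflag.cross_rotation_rotation hs ⟨v, rfl⟩
    have h3 : (√2)⁻¹ * (√2)⁻¹ = 2⁻¹ := by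
      rw [← mul_inv, Real.mul_self_sqrt (by norm_num)]
    rw [h2, mul_inv_cancel₀ (by positivity), one_smul, smul_smul, h3,
      X.skew _ (mfderiv (𝓡 2) (𝓡 7) (curve φ j) x v) s]
    module
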